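/- **Setting.** Let $L\subset(\mathbb R^3,\ker(dz-y\,dx))$ be a smooth Legendrian knot whose front ($xz$-projection) is *nearly plat*: its only singularities are transverse crossings and semicubical cusps, these have pairwise distinct $x$-coordinates, and the front is a slight perturbation of one in which all left cusps have one $x$-coordinate and all right cusps have one $x$-coordinate (so all left cusps lie to the left of, and all right cusps to the right of, all crossings, every left cusp lies to the left of every right cusp, and no left (right) cusp lies between the two strands emanating from another left (right) cusp). Let $\mu$ be a $\mathbb Z$-valued Maslov potential: it is constant on $L$ except at cusps, where the upper strand has value one more than the lower one. Strands over a vertical line are numbered $1,2,\dots$ from top to bottom. A *handleslide mark* is a vertical segment connecting two strands with equal $\mu$ and not meeting crossings or cusps. A *Morse complex sequence* $\mathcal C=(\{(C_m,d_m)\},\{x_m\},H)$ for $L$ consists of values $x_1<\dots<x_M$ and a collection $H$ of handleslide marks such that the lines $x=x_m$ meet the front in non-empty sets, avoid crossings, cusps and marks, and cut it into pieces each containing exactly one crossing, left cusp, right cusp or mark (the piece left of $x_1$ contains a left cusp, the piece right of $x_M$ a right cusp); and of complexes $(C_m,d_m)$ over $\mathbb Z_2$ with basis $e_1,\dots,e_{s_m}$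 the strands at $x_m$, $|e_i|=\mu(e_i)$, with $d_m$ of degree $-1$ and $d_me_i\in\operatorname{span}\{e_j: j>i\}$, subject to the following conditions for the piece between $x_m$ and $x_{m+1}$ (with $C_0=C_{M+1}=0$). * Crossing of strands $k,k+1$: $\langle d_me_k,e_{k+1}\rangle=0$, and exchanging $e_k$ and $e_{k+1}$ is an isomorphism $C_m\to C_{m+1}$. * Left cusp with strands $k,k+1$: $\langle d_{m+1}e_k,e_{k+1}\rangle=1$, and $e_i\mapsto[e_i]$ $(i<k)$, $e_i\mapsto[e_{i+2}]$ $(i\ge k)$ is an isomorphism from $C_m$ to the quotient of $C_{m+1}$ by $\operatorname{span}\{e_k,d_{m+1}e_k\}$. * Right cusp: the same with the roles of $C_m$ and $C_{m+1}$ exchanged. * Handleslide mark between strands $k<l$: $e_k\mapsto e_k+e_l$, $e_i\mapsto e_i$ $(i\ne k)$ is an isomorphism $C_m\to C_{m+1}$. Let $A_{\mathcal C}$ be the $\mathbb Z_2$-vector space with basis the set of crossings and right cusps, and $\mathcal A_{\mathcal C}=\bigoplus_{n\ge0}A_{\mathcal C}^{\otimes n}$ its tensor algebra, graded additively by $|a|=1$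 for a right cusp and $|a|=\mu(T)-\mu(B)$ for a crossing of strands $T,B$, where $T$ has the smaller slope. A chord $(x_m,[i,j])$, $i<j$, is the vertical segment over $x_m$ from strand $i$ down to strand $j$. A *chord path with convex corners* from a generator $a$ to a crossing $b$ is a finite sequence of chords $\Lambda=(\lambda_1,\dots,\lambda_n)$, each on the line $x_m$ immediately to the left of that of its predecessor, with: * if $a$ lies between $x_l$ and $x_{l+1}$ and involves strands $k,k+1$, then $\lambda_1=(x_l,[k,k+1])$; * if $b$ lies between $x_p$ and $x_{p+1}$ and involves strands $k,k+1$, then $\lambda_n=(x_{p+1},[i,k])$ with $\langle d_pe_i,e_k\rangle=1$, or $\lambda_n=(x_{p+1},[k+1,j])$ with $\langle d_pe_{k+1},e_j\rangle=1$; * if $\lambda_r=(x_{m+1},[i,j])$ and $\lambda_{r+1}=(x_m,[i',j'])$, then the piece between $x_m$ and $x_{m+1}$ contains one of the following. * A crossing of strands $k,k+1$: either $[i',j']=[\sigma(i),\sigma(j)]$ with $\sigma=(k\ k{+}1)$ (so $[i,j]\ne[k,k+1]$), or there is a *convex corner* at this crossing: $j=k$ and $[i',j']=[i,k]$ (at the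 bottom of the chord), or $i=k+1$ and $[i',j']=[k+1,j]$ (at the top). * A right cusp with strands $k,k+1$: $[i',j']=[\tau(i),\tau(j)]$, where $\tau(l)=l$ for $l<k$ and $\tau(l)=l+2$ for $l\ge k$. * A handleslide mark between strands $k<l$: $[i',j']=[i,j]$, or $i=k$, $l<j$ and $[i',j']=[l,j]$, or $j=l$, $i<k$ and $[i',j']=[i,k]$. Its word is $w(\Lambda)=f_1\cdots f_s\,b\,h_1\cdots h_t$, where $f_1,\dots,f_s$ are the convex corners at the top read from right to left and $h_1,\dots,h_t$ those at the bottom read from left to right. Let $\mathcal M^{\mathcal C}(a;b_1,\dots,b_n)$ be the set of chord paths with convex corners that begin at $a$ and have word $b_1\cdots b_n$, and let $$d_n\colon A_{\mathcal C}\to A_{\mathcal C}^{\otimes n},\qquad d_na=\sum_{|b_1\cdots b_n|=|a|-1}\#\mathcal M^{\mathcal C}(a;b_1,\dots,b_n)\;b_1\cdots b_n ,$$ with $\#$ the number of elements modulo $2$. **Theorem 5.2.** Only finitely many chord paths with convex corners begin at a given generator. There is a unique linear map $d\colon\mathcal A_{\mathcal C}\to\mathcal A_{\mathcal C}$ with $da=\sum_{n\ge1}d_na$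 on $A_{\mathcal C}$ and the Leibniz rule $d(uv)=(du)v+u(dv)$, and $(\mathcal A_{\mathcal C},d)$ is a DGA: $\mathcal A_{\mathcal C}$ is a graded algebra, $d$ has degree $-1$, and $d^2=0$. -/

import Mathlib

open scoped ContDiff Topology

noncomputable section

/-! ### Legendrian knots, their fronts and Maslov potentials -/

/-- A Legendrian knot in `ℝ³` with the contact structure `ker (dz - y dx)`: a smooth embedded
closed curve, given by a parametrization with period `1`, everywhere tangent to the contact
planes. Parameters that differ by an integer are the same point of the knot. -/
structure LegendrianKnot where
  x : ℝ → ℝ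
  y : ℝ → ℝ
  z : ℝ → ℝ
  contDiff_x : ContDiff ℝ ∞ x
  contDiff_y : ContDiff ℝ ∞ y
  contDiff_z : ContDiff ℝ ∞ z
  periodic_x : Function.Periodic x 1
  periodic_y : Function.Periodic y 1
  periodic_z : Function.Periodic z 1
  immersed : ∀ t, ¬ (deriv x t = 0 ∧ deriv y t = 0 ∧ deriv z t = 0)
  embedded : ∀ s t, x s = x t → y s = y t → z s = z t → ∃ n : ℤ, t = s + n
  legendrian : ∀ t, deriv z t = y t * deriv x t

namespace LegendrianKnot

variable (L : LegendrianKnot)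

/-- A crossing of the front projection `t ↦ (x t, z t)`: two points `T`, `B` of the knot lying
over the same point of the front. Along the front `y = dz/dx` is the slope; since the knot is
embedded the two slopes differ, and `T` denotes the strand of smaller slope. -/
structure Crossing where
  T : ℝ
  B : ℝ
  T_mem : T ∈ Set.Ico (0 : ℝ) 1
  B_mem : B ∈ Set.Ico (0 : ℝ) 1
  x_eq : L.x T = L.x B
  z_eq : L.z T = L.z B
  slope_lt : L.y T < L.y B

/-- A cusp of the front projection: a point where the front is not immersed. -/
structure Cusp where
  t : ℝ
  t_mem : t ∈ Set.Ico (0 : ℝ) 1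
  deriv_x : deriv L.x t = 0

variable {L}

/-- At a left cusp `x` has a local minimum along the knot. -/
def Cusp.IsLeft (c : L.Cusp) : Prop := 0 < deriv (deriv L.x) c.t

/-- At a right cusp `x` has a local maximum along the knot. -/
def Cusp.IsRight (c : L.Cusp) : Prop := deriv (deriv L.x) c.t < 0

variable (L)

/-- The singularities of the front: its crossings and cusps. -/
abbrev Singularity : Type := L.Crossing ⊕ L.Cusp

variable {L}

/-- The `x`-coordinate of a singularity of the front. -/
def Singularity.xCoord : L.Singularity → ℝ
  | .inl c => L.x c.T
  | .inr c => L.x c.t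

/-- The `z`-coordinate of a singularity of the front. -/
def Singularity.zCoord : L.Singularity → ℝ
  | .inl c => L.z c.T
  | .inr c => L.z c.t

variable (L)

/-- The number of points of the knot lying strictly above the point `t` on the vertical line
through the image of `t` in the front. -/
def strandsAbove (t : ℝ) : ℕ :=
  Set.ncard {u : ℝ | u ∈ Set.Ico (0 : ℝ) 1 ∧ L.x u = L.x t ∧ L.z t < L.z u}

/-- The front is generic: its singularities are transverse crossings and semicubical cusps, and
they have pairwise distinct `x`-coordinates. (As `y` is the slope of the front and the knot is an
embedded curve, a cusp is semicubical exactly if `x'' ≠ 0` there, and double points away from cusps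
are transverse; a triple point, or a cusp on another strand, would give two singularities with
the same `x`-coordinate.) -/
structure IsGenericFront : Prop where
  semicubical : ∀ c : L.Cusp, deriv (deriv L.x) c.t ≠ 0
  xCoord_injective : Function.Injective (Singularity.xCoord (L := L))

/-- The front is nearly plat, i.e. it arises by a slight perturbation from a generic front all of
whose left cusps have one `x`-coordinate and all of whose right cusps have one `x`-coordinate:
all left cusps lie to the left of all crossings and of all right cusps, all right cusps lie to the
right of all crossings, and, the cusps having been on one vertical line, no cusp lies between the
two strands that emanate from another cusp on its side. Over the range of the left (resp. right)
cusps the front consists of such pairs of strands, so the last condition says that the number of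
strands above a cusp is even. -/
structure IsNearlyPlat : Prop extends L.IsGenericFront where
  left_lt_crossing : ∀ (c : L.Cusp) (q : L.Crossing), c.IsLeft → L.x c.t < L.x q.T
  crossing_lt_right : ∀ (q : L.Crossing) (c : L.Cusp), c.IsRight → L.x q.T < L.x c.t
  left_lt_right : ∀ c c' : L.Cusp, c.IsLeft → c'.IsRight → L.x c.t < L.x c'.t
  not_nested : ∀ c : L.Cusp, Even (L.strandsAbove c.t)

/-- A Maslov potential: an integer valued function on the knot which is constant except at cusps,
where its value on the upper strand is one more than its value on the lower strand.
(The values at the cusps themselves are irrelevant.) -/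
structure MaslovPotential where
  μ : ℝ → ℤ
  periodic : Function.Periodic μ 1
  eq_of_no_cusp : ∀ s t, s ≤ t → (∀ u ∈ Set.Icc s t, deriv L.x u ≠ 0) → μ s = μ t
  cusp : ∀ t, deriv L.x t = 0 → ∀ᶠ p : ℝ × ℝ in 𝓝 (t, t),
    L.x p.1 = L.x p.2 → L.z p.1 < L.z p.2 → μ p.2 = μ p.1 + 1

/-- The set `Q(L)` of generators: the crossings and the right cusps of the front. -/
abbrev Generator : Type := L.Crossing ⊕ {c : L.Cusp // c.IsRight}

variable {L}

/-- The degree of a generator: `μ(T) - μ(B)` for a crossing, `1` for a right cusp. -/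
def MaslovPotential.degree (mu : L.MaslovPotential) : L.Generator → ℤ
  | .inl c => mu.μ c.T - mu.μ c.B
  | .inr _ => 1

/-- The degree of a word (monomial) in the generators. -/
def MaslovPotential.wordDegree (mu : L.MaslovPotential) (w : List L.Generator) : ℤ :=
  (w.map mu.degree).sum

/-! ### Decomposition of a front into elementary marked tangles -/

/-- A handleslide mark: a vertical segment connecting two strands with the same Maslov potential
and not meeting the crossings and cusps of the front. -/
structure HandleslideMark (mu : L.MaslovPotential) where
  top : ℝ
  bot : ℝ
  top_mem : top ∈ Set.Ico (0 : ℝ) 1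
  bot_mem : bot ∈ Set.Ico (0 : ℝ) 1
  x_eq : L.x top = L.x bot
  z_lt : L.z bot < L.z top
  μ_eq : mu.μ top = mu.μ bot
  avoids : ∀ σ : L.Singularity, σ.xCoord = L.x top →
    ¬ (L.z bot ≤ σ.zCoord ∧ σ.zCoord ≤ L.z top)

/-- The content of an elementary marked tangle: a single crossing, left cusp or right cusp between
the strands labeled `k` and `k + 1`, or a handleslide mark between the strands `k` and `l`. -/
inductive Tangle (mu : L.MaslovPotential) : Type
  | crossing (c : L.Crossing) (k : ℕ)
  | leftCusp (c : {c : L.Cusp // c.IsLeft}) (k : ℕ)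
  | rightCusp (c : {c : L.Cusp // c.IsRight}) (k : ℕ)
  | handleslide (h : HandleslideMark mu) (k l : ℕ)

variable (L)

/-- The points `p`, `q` of the knot are the ends of an arc of the knot that contains no cusp,
except that `q` itself may be a cusp. In the front such an arc is a graph over the `x`-axis. -/
def Joined (p q : ℝ) : Prop :=
  ∃ n : ℤ, ∀ u ∈ Set.uIcc p (q + n), deriv L.x u = 0 → u = q + n

/-- Vertical lines `x = X 1 < ⋯ < X M`, each meeting the front in a non-empty set of points and
avoiding crossings and cusps, together with the labeling of the points of the knot over them: the
points over `x = X m` are `pt m 1, …, pt m (s m)`, from top to bottom. By convention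
`s 0 = s (M + 1) = 0`, as if there were two further lines, to the left and to the right of the
whole front; the other values at indices outside the stated ranges carry no meaning. -/
structure LabeledLines where
  M : ℕ
  one_le_M : 1 ≤ M
  X : ℕ → ℝ
  X_lt : ∀ m, 1 ≤ m → m < M → X m < X (m + 1)
  s : ℕ → ℕ
  s_zero : s 0 = 0
  s_last : s (M + 1) = 0
  s_pos : ∀ m, 1 ≤ m → m ≤ M → 0 < s m
  pt : ℕ → ℕ → ℝ
  pt_mem : ∀ m i, 1 ≤ m → m ≤ M → 1 ≤ i → i ≤ s m → pt m i ∈ Set.Ico (0 : ℝ) 1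
  x_pt : ∀ m i, 1 ≤ m → m ≤ M → 1 ≤ i → i ≤ s m → L.x (pt m i) = X m
  z_pt_lt : ∀ m i j, 1 ≤ m → m ≤ M → 1 ≤ i → i < j → j ≤ s m → L.z (pt m j) < L.z (pt m i)
  exists_pt : ∀ m t, 1 ≤ m → m ≤ M → t ∈ Set.Ico (0 : ℝ) 1 → L.x t = X m →
    ∃ i, 1 ≤ i ∧ i ≤ s m ∧ pt m i = t
  avoids : ∀ m (σ : L.Singularity), 1 ≤ m → m ≤ M → σ.xCoord ≠ X m

variable {L}

/-- `u` lies in the open interval between `X m` and `X (m + 1)`, for `0 ≤ m ≤ M`, where `X 0` and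
`X (M + 1)` are understood as `-∞` and `∞`. -/
def LabeledLines.Between (V : L.LabeledLines) (m : ℕ) (u : ℝ) : Prop :=
  (1 ≤ m → V.X m < u) ∧ (m < V.M → u < V.X (m + 1))

/-- The relabeling of strands at a cusp between strands `k` and `k + 1`, from the side of the cusp
with fewer strands to the side with more. -/
def skip (k i : ℕ) : ℕ := if i < k then i else i + 2

/-- The portion of the front between the `m`-th and `(m + 1)`-st line is an elementary tangle with
the given content. The singularity or mark lies there, and no other singularity does; the labels
`k`, `k + 1` of the strands meeting at a singularity are given by its height; and the arcs of the
knot in this portion connect the labeled points on the two sides in the expected way. At a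
crossing, the strand which is the upper one on the left is the strand of smaller slope. -/
def LabeledLines.IsElementary {mu : L.MaslovPotential} (V : L.LabeledLines) (m : ℕ) :
    Tangle mu → Prop
  | .crossing c k =>
      V.Between m (L.x c.T) ∧ (∀ σ : L.Singularity, V.Between m σ.xCoord → σ = .inl c) ∧
      V.s (m + 1) = V.s m ∧ k = L.strandsAbove c.T + 1 ∧ k + 1 ≤ V.s m ∧
      (∀ i, 1 ≤ i → i ≤ V.s m → L.Joined (V.pt m i) (V.pt (m + 1) (Equiv.swap k (k + 1) i))) ∧
      L.Joined (V.pt m k) c.T ∧ L.Joined (V.pt m (k + 1)) c.B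
  | .leftCusp c k =>
      V.Between m (L.x c.1.t) ∧ (∀ σ : L.Singularity, V.Between m σ.xCoord → σ = .inr c.1) ∧
      V.s (m + 1) = V.s m + 2 ∧ k = L.strandsAbove c.1.t + 1 ∧ k + 1 ≤ V.s (m + 1) ∧
      (∀ i, 1 ≤ i → i ≤ V.s m → L.Joined (V.pt m i) (V.pt (m + 1) (skip k i))) ∧
      L.Joined (V.pt (m + 1) k) c.1.t ∧ L.Joined (V.pt (m + 1) (k + 1)) c.1.t
  | .rightCusp c k =>
      V.Between m (L.x c.1.t) ∧ (∀ σ : L.Singularity, V.Between m σ.xCoord → σ = .inr c.1) ∧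
      V.s m = V.s (m + 1) + 2 ∧ k = L.strandsAbove c.1.t + 1 ∧ k + 1 ≤ V.s m ∧
      (∀ i, 1 ≤ i → i ≤ V.s (m + 1) → L.Joined (V.pt (m + 1) i) (V.pt m (skip k i))) ∧
      L.Joined (V.pt m k) c.1.t ∧ L.Joined (V.pt m (k + 1)) c.1.t
  | .handleslide h k l =>
      V.Between m (L.x h.top) ∧ (∀ σ : L.Singularity, ¬ V.Between m σ.xCoord) ∧
      V.s (m + 1) = V.s m ∧ 1 ≤ k ∧ k < l ∧ l ≤ V.s m ∧
      (∀ i, 1 ≤ i → i ≤ V.s m → L.Joined (V.pt m i) (V.pt (m + 1) i)) ∧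
      L.Joined (V.pt m k) h.top ∧ L.Joined (V.pt m l) h.bot

end LegendrianKnot

/-! ### Ordered complexes over `ℤ/2` -/

/-- The `ℤ/2` vector space with basis `e_i`, `i : ℕ`, where `e_i = Finsupp.single i 1`. -/
abbrev ChainSpace : Type := ℕ →₀ ZMod 2

/-- The vector space with basis `e_1, …, e_s`. -/
def chains (s : ℕ) : Submodule (ZMod 2) ChainSpace :=
  Submodule.span (ZMod 2) ((fun i => Finsupp.single i 1) '' Set.Icc 1 s)

/-- The linear map `e_i ↦ ∑_{1 ≤ j ≤ s} c_{ij} e_j`. -/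
def coeffMap (s : ℕ) (c : ℕ → ℕ → ZMod 2) : ChainSpace →ₗ[ZMod 2] ChainSpace :=
  Finsupp.linearCombination (ZMod 2) fun i => ∑ j ∈ Finset.Icc 1 s, Finsupp.single j (c i j)

/-- A complex with basis `e_1, …, e_s`, where `e_i` has degree `deg i`, and a triangular
differential `d e_i = ∑_{j > i} c_{ij} e_j` of degree `-1`; thus `c_{ij} = ⟨d e_i, e_j⟩`. -/
structure OrderedComplex (s : ℕ) (deg : ℕ → ℤ) where
  coeff : ℕ → ℕ → ZMod 2
  triangular : ∀ i j, coeff i j ≠ 0 → 1 ≤ i ∧ i < j ∧ j ≤ s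
  degree : ∀ i j, coeff i j ≠ 0 → deg j = deg i - 1
  sq_zero : coeffMap s coeff ∘ₗ coeffMap s coeff = 0

/-- The differential of an ordered complex (extended by zero to the other basis vectors). -/
def OrderedComplex.d {s : ℕ} {deg : ℕ → ℤ} (K : OrderedComplex s deg) :
    ChainSpace →ₗ[ZMod 2] ChainSpace := coeffMap s K.coeff

/-- `φ` restricts to an isomorphism of complexes from `(U, d)` to `(U', d')`. -/
structure IsComplexIso {V W : Type} [AddCommGroup V] [Module (ZMod 2) V] [AddCommGroup W]
    [Module (ZMod 2) W] (U : Submodule (ZMod 2) V) (d : V →ₗ[ZMod 2] V)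
    (U' : Submodule (ZMod 2) W) (d' : W →ₗ[ZMod 2] W) (φ : V →ₗ[ZMod 2] W) : Prop where
  bijOn : Set.BijOn φ U U'
  comm : ∀ v ∈ U, φ (d v) = d' (φ v)

/-- The linear map `e_i ↦ e_{f i}`. -/
def relabel (f : ℕ → ℕ) : ChainSpace →ₗ[ZMod 2] ChainSpace := Finsupp.lmapDomain _ _ f

/-- The handleslide map `h_{k,l}`, sending `e_k` to `e_k + e_l` and `e_i` to `e_i` for `i ≠ k`. -/
def handleslideMap (k l : ℕ) : ChainSpace →ₗ[ZMod 2] ChainSpace :=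
  Finsupp.linearCombination (ZMod 2) fun i =>
    if i = k then Finsupp.single k 1 + Finsupp.single l 1 else Finsupp.single i 1

/-- The subcomplex spanned by `e_k` and `d e_k`. -/
def OrderedComplex.cuspSub {s : ℕ} {deg : ℕ → ℤ} (K : OrderedComplex s deg) (k : ℕ) :
    Submodule (ZMod 2) ChainSpace :=
  Submodule.span (ZMod 2) {Finsupp.single k 1, K.d (Finsupp.single k 1)}

theorem OrderedComplex.cuspSub_le {s : ℕ} {deg : ℕ → ℤ} (K : OrderedComplex s deg) (k : ℕ) :
    K.cuspSub k ≤ (K.cuspSub k).comap K.d := by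
  refine Submodule.span_le.2 ?_
  rintro v (rfl | rfl)
  · exact Submodule.subset_span (Or.inr rfl)
  · have h : K.d (K.d (Finsupp.single k 1)) = 0 :=
      LinearMap.congr_fun K.sq_zero (Finsupp.single k 1)
    simp only [SetLike.mem_coe, Submodule.mem_comap, h, Submodule.zero_mem]

/-- The relation between the complex `K` on the side of a cusp with fewer strands and the complex
`K'` on the side with more strands: with `k`, `k + 1` the labels of the strands meeting at the
cusp, `e_i ↦ [e_i]` for `i < k`, `e_i ↦ [e_{i+2}]` for `i ≥ k` is an isomorphism from `K` to the
quotient of `K'` by the subcomplex spanned by `e_k` and `d e_k`. -/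
def CuspRelation {s s' : ℕ} {deg deg' : ℕ → ℤ} (K : OrderedComplex s deg)
    (K' : OrderedComplex s' deg') (k : ℕ) : Prop :=
  IsComplexIso (chains s) K.d
    ((chains s').map (K'.cuspSub k).mkQ)
    ((K'.cuspSub k).mapQ (K'.cuspSub k) K'.d (K'.cuspSub_le k))
    ((K'.cuspSub k).mkQ ∘ₗ relabel (LegendrianKnot.skip k))

/-! ### Morse complex sequences -/

namespace LegendrianKnot

variable {L : LegendrianKnot}

/-- A Morse complex sequence for the front of `L` with Maslov potential `mu`. The vertical lines
cut the front into elementary marked tangles `tangle 0, …, tangle M`, where `tangle m` lies between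
`X m` and `X (m + 1)`; the first one lies to the left of `X 1` and the last one to the right of
`X M` (with the convention for `LabeledLines` these are the leftmost left cusp and the rightmost
right cusp). The handleslide marks of the sequence are those which occur in the tangles.
`complex m` is the complex `(C_m, d_m)`; it is zero for `m = 0` and `m = M + 1`. -/
structure MCS (mu : L.MaslovPotential) extends L.LabeledLines where
  tangle : ℕ → Tangle mu
  elementary : ∀ m ≤ M, toLabeledLines.IsElementary m (tangle m)
  complex : ∀ m, OrderedComplex (s m) fun i => mu.μ (pt m i)
  compatible : ∀ m ≤ M, match tangle m with
    | .crossing _ k => (complex m).coeff k (k + 1) = 0 ∧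
        IsComplexIso (chains (s m)) (complex m).d (chains (s (m + 1))) (complex (m + 1)).d
          (relabel (Equiv.swap k (k + 1)))
    | .leftCusp _ k => (complex (m + 1)).coeff k (k + 1) = 1 ∧
        CuspRelation (complex m) (complex (m + 1)) k
    | .rightCusp _ k => (complex m).coeff k (k + 1) = 1 ∧
        CuspRelation (complex (m + 1)) (complex m) k
    | .handleslide _ k l =>
        IsComplexIso (chains (s m)) (complex m).d (chains (s (m + 1))) (complex (m + 1)).d
          (handleslideMap k l)

/-- The chord `(X m, [i, j])`: the vertical segment over `x = X m` with upper end point on the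
`i`-th strand and lower end point on the `j`-th strand. -/
structure Chord where
  m : ℕ
  i : ℕ
  j : ℕ

namespace MCS

variable {mu : L.MaslovPotential} (C : L.MCS mu)

/-- The chord lies on one of the lines and connects two strands there. -/
def IsChord (r : Chord) : Prop := 1 ≤ r.m ∧ r.m ≤ C.M ∧ 1 ≤ r.i ∧ r.i < r.j ∧ r.j ≤ C.s r.m

/-- The chord `r'` may follow the chord `r` in a chord path with convex corners: it lies on the
next line to the left, and its end points are restricted by the tangle in between. At a crossing,
the first alternative is to follow the strands (this is impossible for `[k, k + 1]`, because `r'`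
has to be a chord), the other two are the convex corners, at the lower and at the upper end point
of the chord. -/
def Step (r r' : Chord) : Prop :=
  r'.m + 1 = r.m ∧
  match C.tangle r'.m with
  | .crossing _ k =>
      (r'.i = Equiv.swap k (k + 1) r.i ∧ r'.j = Equiv.swap k (k + 1) r.j) ∨
      (r.j = k ∧ r'.i = r.i ∧ r'.j = k) ∨
      (r.i = k + 1 ∧ r'.i = k + 1 ∧ r'.j = r.j)
  | .leftCusp _ _ => False
  | .rightCusp _ k => r'.i = skip k r.i ∧ r'.j = skip k r.j
  | .handleslide _ k l =>
      (r'.i = r.i ∧ r'.j = r.j) ∨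
      (r.i = k ∧ l < r.j ∧ r'.i = l ∧ r'.j = r.j) ∨
      (r.j = l ∧ r.i < k ∧ r'.i = r.i ∧ r'.j = k)

/-- `r` is the originating chord `(X l, [k, k + 1])` of chord paths from `a`. -/
def IsOriginating (r : Chord) (a : L.Generator) : Prop :=
  match C.tangle r.m with
  | .crossing c k => a = .inl c ∧ r.i = k ∧ r.j = k + 1
  | .rightCusp c k => a = .inr c ∧ r.i = k ∧ r.j = k + 1
  | _ => False

/-- A chord path can terminate at the crossing `b` with the chord `r`: if `b` lies between `X p`
and `X (p + 1)` and involves strands `k`, `k + 1`, then `r` is `(X (p + 1), [i, k])` with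
`⟨d_p e_i, e_k⟩ = 1` or `(X (p + 1), [k + 1, j])` with `⟨d_p e_{k+1}, e_j⟩ = 1`. -/
def IsTerminating (r : Chord) (b : L.Crossing) : Prop :=
  ∃ p k, r.m = p + 1 ∧ C.tangle p = .crossing b k ∧
    ((r.j = k ∧ (C.complex p).coeff r.i k = 1) ∨
      (r.i = k + 1 ∧ (C.complex p).coeff (k + 1) r.j = 1))

/-- The convex corner at the lower (bottom) end point between successive chords, if there is one. -/
def bottomCorner (r r' : Chord) : List L.Generator :=
  match C.tangle r'.m with
  | .crossing c k => if r.j = k ∧ r'.j = k then [.inl c] else []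
  | _ => []

/-- The convex corner at the upper (top) end point between successive chords, if there is one. -/
def topCorner (r r' : Chord) : List L.Generator :=
  match C.tangle r'.m with
  | .crossing c k => if r.i = k + 1 ∧ r'.i = k + 1 then [.inl c] else []
  | _ => []

/-- The word `f_1 ⋯ f_s b h_1 ⋯ h_t` of a sequence of chords terminating at `b`: the `f`'s are the
convex corners at the top, read from right to left, the `h`'s are those at the bottom, read from
left to right (the sequence itself runs from right to left). -/
def word (b : L.Crossing) : List Chord → List L.Generator
  | r :: r' :: rest => C.topCorner r r' ++ word b (r' :: rest) ++ C.bottomCorner r r'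
  | _ => [.inl b]

/-- `Λ` is a chord path with convex corners from `a`, terminating at `b`. -/
structure IsChordPath (Λ : List Chord) (a : L.Generator) (b : L.Crossing) : Prop where
  isChord : ∀ r ∈ Λ, C.IsChord r
  step : Λ.IsChain C.Step
  originating : ∃ r, Λ.head? = some r ∧ C.IsOriginating r a
  terminating : ∃ r, Λ.getLast? = some r ∧ C.IsTerminating r b

/-- The set `M^C(a; b_1, …, b_n)` of chord paths with convex corners which begin at `a` and have
word `w = b_1 ⋯ b_n`. -/
def chordPaths (a : L.Generator) (w : List L.Generator) : Set (List Chord) :=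
  {Λ | ∃ b, C.IsChordPath Λ a b ∧ C.word b Λ = w}

end MCS

/-! ### The algebra and its differential -/

variable (L)

/-- The `ℤ/2` vector space with basis the crossings and right cusps of the front. -/
abbrev GenSpace : Type := L.Generator →₀ ZMod 2

/-- The tensor algebra of `GenSpace`. -/
abbrev Alg : Type := TensorAlgebra (ZMod 2) L.GenSpace

variable {L}

/-- The monomial `b_1 ⋯ b_n` in the tensor algebra. -/
def monomial (w : List L.Generator) : L.Alg :=
  (w.map fun b => TensorAlgebra.ι (ZMod 2) (Finsupp.single b 1 : L.GenSpace)).prod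

/-- The homogeneous part of degree `k` of the tensor algebra, spanned by the monomials of
degree `k`. -/
def MaslovPotential.grading (mu : L.MaslovPotential) (k : ℤ) : Submodule (ZMod 2) L.Alg :=
  Submodule.span (ZMod 2) {u | ∃ w, mu.wordDegree w = k ∧ u = monomial w}

/-- The linear map `d_n`, with
`d_n a = ∑ #M^C(a; b_1, …, b_n) b_1 ⋯ b_n`, the sum over all monomials of length `n` and of degree
`|a| - 1`, with the number of elements counted modulo `2`. -/
def MCS.dn {mu : L.MaslovPotential} (C : L.MCS mu) (n : ℕ) : L.GenSpace →ₗ[ZMod 2] L.Alg :=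
  Finsupp.linearCombination (ZMod 2) fun a =>
    ∑ᶠ (w : List L.Generator) (_ : w.length = n ∧ mu.wordDegree w = mu.degree a - 1),
      ((C.chordPaths a w).ncard : ZMod 2) • monomial w

end LegendrianKnot

end

/-!
The differential of `𝒜_C` is the derivation `d` extending the sum over words of chord paths, and
the point is to prove `d ∘ d = 0`. For a chord `(X m, [i, j])` let `E i j` be the sum of the words
of all chord paths that start with it (`MCS.pathSum`), so that `d a` is `E k (k + 1)` for the
originating chord of the generator `a`. Reading off the first step of a path expresses the matrix
`E` at one line by the matrix at the line to its left. Let `D` be the matrix of the differential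
of the complex at the line, and `F = D + E` (`MCS.connection`), which is strictly upper triangular.

At a handleslide mark, `F` passes to `(1 + N) F (1 + N)` with `N` the elementary matrix with entry
`1` in position `(k, l)`; at a crossing `b` it passes to `(1 + N) F (1 + N) + d N`, up to exchanging
two strands, where `N` has the entry `b` in position `(k, k + 1)`: the terms `N F` and `F N` stem
from the convex corners and the terminating chords, and `d N` removes the entry `d b = F k (k + 1)`
that would otherwise destroy triangularity. These are gauge transformations, and they
preserve the Maurer–Cartan equation `d F = F ^ 2` (`IsMaurerCartan.gauge`). To the right of a left
cusp `E = 0`, as no chord path gets past the cusp or ends at it, and the equation says `D ^ 2 = 0`. Hence it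
holds at all lines without right cusps to their left, in particular to the left of every crossing
(`MCS.isMaurerCartan_connection`). Triangularity gives `d (F k (k + 1)) = (F ^ 2) k (k + 1) = 0`,
which is `d (d a) = 0` for a crossing `a`.

For a right cusp the equation is not available, but it is not needed: since the front is nearly
plat, a right cusp joins strands `k`, `k + 1` with `k` odd, and a chord between such strands
is carried to another one by every right cusp and handleslide on its way to the left, until a line
is reached where the equation holds (`MCS.diff_pathSum_odd`).

That `d` has degree `-1`, and that the degree condition in the definition of `d_n` omits nothing,
follows from `MCS.wordDegree_of_mem_pathsFrom`: along a chord path the degree of the chord drops by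
the degree of each convex corner, and the degree of the last chord exceeds that of the terminal
crossing by one.
-/

noncomputable section

/-! ### Derivations of a tensor algebra -/

namespace TensorAlgebra

variable {R V : Type*} [CommRing R] [AddCommGroup V] [Module R V]

/-- The algebra map `u ↦ u + ε D u` into the square zero extension by which a derivation `D`
with prescribed values on generators is constructed. -/
def derivLift (f : V →ₗ[R] TensorAlgebra R V) :
    TensorAlgebra R V →ₐ[R] TrivSqZeroExt (TensorAlgebra R V) (TensorAlgebra R V) :=
  lift R ((TrivSqZeroExt.inlAlgHom R (TensorAlgebra R V) (TensorAlgebra R V)).toLinearMap ∘ₗ ι R +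
    (TrivSqZeroExt.inrHom (TensorAlgebra R V) (TensorAlgebra R V)).restrictScalars R ∘ₗ f)

theorem fst_derivLift (f : V →ₗ[R] TensorAlgebra R V) (u : TensorAlgebra R V) :
    (derivLift f u).fst = u := by
  have h : (TrivSqZeroExt.fstHom R (TensorAlgebra R V) (TensorAlgebra R V)).comp (derivLift f) =
      AlgHom.id R _ := by
    ext v
    simp [derivLift]
  exact DFunLike.congr_fun h u

/-- The derivation of the tensor algebra with values `f` on generators. -/
def derivOf (f : V →ₗ[R] TensorAlgebra R V) : TensorAlgebra R V →ₗ[R] TensorAlgebra R V :=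
  (TrivSqZeroExt.sndHom (TensorAlgebra R V) (TensorAlgebra R V)).restrictScalars R ∘ₗ
    (derivLift f).toLinearMap

theorem derivOf_ι (f : V →ₗ[R] TensorAlgebra R V) (v : V) : derivOf f (ι R v) = f v := by
  simp [derivOf, derivLift]

theorem derivOf_mul (f : V →ₗ[R] TensorAlgebra R V) (u v : TensorAlgebra R V) :
    derivOf f (u * v) = derivOf f u * v + u * derivOf f v := by
  have := fst_derivLift f
  simp only [derivOf, LinearMap.comp_apply, AlgHom.toLinearMap_apply, map_mul,
    LinearMap.restrictScalars_apply, TrivSqZeroExt.sndHom_apply, TrivSqZeroExt.snd_mul, this,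
    smul_eq_mul, MulOpposite.smul_eq_mul_unop, MulOpposite.unop_op]
  rw [add_comm]

theorem map_algebraMap_of_leibniz {d : TensorAlgebra R V →ₗ[R] TensorAlgebra R V}
    (hd : ∀ u v, d (u * v) = d u * v + u * d v) (c : R) : d (algebraMap R _ c) = 0 := by
  have h : d 1 = 0 := by simpa using hd 1 1
  rw [Algebra.algebraMap_eq_smul_one, map_smul, h, smul_zero]

/-- A derivation is determined by its values on generators. -/
theorem eq_of_leibniz {d d' : TensorAlgebra R V →ₗ[R] TensorAlgebra R V}
    (hd : ∀ u v, d (u * v) = d u * v + u * d v) (hd' : ∀ u v, d' (u * v) = d' u * v + u * d' v)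
    (h : ∀ v, d (ι R v) = d' (ι R v)) : d = d' := by
  ext u
  induction u using TensorAlgebra.induction with
  | algebraMap c => rw [map_algebraMap_of_leibniz hd, map_algebraMap_of_leibniz hd']
  | ι v => exact h v
  | mul u v hu hv => rw [hd, hd', hu, hv]
  | add u v hu hv => rw [map_add, map_add, hu, hv]

end TensorAlgebra

/-! ### The Maurer–Cartan equation and gauge transformations -/

/-- The Maurer–Cartan equation `d F = F ^ 2` for a matrix `F` with rows and columns `1, …, s`.
(There is no sign since it is used over `ℤ/2` only.) -/
def IsMaurerCartan {A : Type*} [Ring A] (d : A → A) (s : ℕ) (F : ℕ → ℕ → A) : Prop :=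
  ∀ i ∈ Finset.Icc 1 s, ∀ j ∈ Finset.Icc 1 s, d (F i j) = ∑ p ∈ Finset.Icc 1 s, F i p * F p j

namespace IsMaurerCartan

variable {A : Type*} [Ring A] {s : ℕ} {F : ℕ → ℕ → A}

theorem congr {d : A → A} {F' : ℕ → ℕ → A} (hF : IsMaurerCartan d s F)
    (h : ∀ i ∈ Finset.Icc 1 s, ∀ j ∈ Finset.Icc 1 s, F' i j = F i j) : IsMaurerCartan d s F' := by
  intro i hi j hj
  rw [h i hi j hj, hF i hi j hj]
  exact Finset.sum_congr rfl fun p hp => by rw [h i hi p hp, h p hp j hj]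

theorem relabel {d : A → A} (hF : IsMaurerCartan d s F) (σ : Equiv.Perm ℕ)
    (hσ : ∀ i, σ i ∈ Finset.Icc 1 s ↔ i ∈ Finset.Icc 1 s) :
    IsMaurerCartan d s fun i j => F (σ i) (σ j) := by
  intro i hi j hj
  rw [hF _ ((hσ i).2 hi) _ ((hσ j).2 hj)]
  exact (Finset.sum_equiv σ (fun p => (hσ p).symm) fun p _ => rfl).symm

/-- The Maurer–Cartan equation is preserved by the gauge transformation
`F ↦ (1 + N) F (1 + N) + d N`, where `N` has the single entry `b` in position `(k, l)`; here
`1 + N` is its own inverse and `F l k = 0` kills the quadratic term `N F N`. -/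
theorem gauge [CharP A 2] {d : A →+ A} (hd : ∀ u v, d (u * v) = d u * v + u * d v)
    (hF : IsMaurerCartan d s F) {k l : ℕ} (hk : k ∈ Finset.Icc 1 s) (hl : l ∈ Finset.Icc 1 s)
    (hkl : k ≠ l) (hlk : F l k = 0) {b : A} (hb : d (d b) = 0) :
    IsMaurerCartan d s fun i j => F i j + (if i = k then b * F l j else 0) +
      (if j = l then F i k * b else 0) + (if i = k then if j = l then d b else 0 else 0) := by
  have h0 : ∑ p ∈ Finset.Icc 1 s, F l p * F p k = 0 := by rw [← hF l hl k hk, hlk, map_zero]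
  intro i hi j hj
  have h1 : ∀ x : A, x + x = 0 := CharTwo.add_self_eq_zero
  have h2 : ∑ p ∈ Finset.Icc 1 s, F l p * F p k * b = 0 := by rw [← Finset.sum_mul, h0, zero_mul]
  have h3 : ∑ p ∈ Finset.Icc 1 s, b * F l p * (F p k * b) = 0 := by
    simp only [mul_assoc, ← Finset.mul_sum]
    simp only [← mul_assoc] at h2 ⊢
    rw [h2, mul_zero]
  have hlj := hF l hl j hj
  have hij := hF i hi j hj
  have hik := hF i hi k hk
  have e1 : ∑ p ∈ Finset.Icc 1 s, b * F l p * F p j = b * d (F l j) := by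
    rw [hlj, Finset.mul_sum]; simp only [mul_assoc]
  have e2 : ∑ p ∈ Finset.Icc 1 s, F i p * (F p k * b) = d (F i k) * b := by
    rw [hik, Finset.sum_mul]; simp only [mul_assoc]
  -- no index equals both `k` and `l`, which accounts for `N * N = 0` and `d N * N = 0`
  have h4 : ∀ z : A, (∑ x ∈ Finset.Icc 1 s, if x = k ∧ x = l then z else 0) = 0 := fun z =>
    Finset.sum_eq_zero fun x _ => if_neg fun h => hkl (h.1.symm.trans h.2)
  have h5 : ∀ z x : A, z + x + x = z := fun z x => by rw [add_assoc, h1, add_zero]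
  beta_reduce
  by_cases hi' : i = k <;> by_cases hj' : j = l
  · subst hi' hj'
    simp only [if_true, map_add, hd, add_mul, mul_add, Finset.sum_add_distrib, ← hij, e1, e2, hb, h3]
    simp [hk, hl, hlk, ← ite_and, h4, mul_assoc]
    generalize F i i * (b * F j j) = x
    grind
  · subst hi'
    simp only [if_true, hj', if_false, map_add, hd, add_mul, mul_add, Finset.sum_add_distrib, ← hij, e1]
    simp [hk, hl, hlk, ← ite_and, h4, mul_assoc]
    generalize F i i * (b * F l j) = x
    grind
  · subst hj'
    simp only [if_true, hi', if_false, map_add, hd, add_mul, mul_add, Finset.sum_add_distrib, ← hij, e2]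
    simp [hk, hl, hlk, ← ite_and, h4, mul_assoc]
    generalize F i k * (b * F j j) = x
    grind
  · simp only [hi', hj', if_false, map_add, add_mul, mul_add, Finset.sum_add_distrib, ← hij]
    simp [hk, hl, ← ite_and, h4, mul_assoc]
    rw [h5]

end IsMaurerCartan

/-! ### The graded tensor algebra -/

namespace LegendrianKnot

variable {L : LegendrianKnot} (mu : L.MaslovPotential)

@[simp] theorem monomial_nil : monomial ([] : List L.Generator) = 1 := rfl

theorem monomial_cons (a : L.Generator) (w : List L.Generator) :
    monomial (a :: w) = TensorAlgebra.ι (ZMod 2) (Finsupp.single a 1 : L.GenSpace) * monomial w := by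
  simp [monomial]

theorem monomial_append (v w : List L.Generator) :
    monomial (v ++ w) = monomial v * monomial w := by
  simp [monomial]

theorem monomial_singleton (a : L.Generator) :
    monomial [a] = TensorAlgebra.ι (ZMod 2) (Finsupp.single a 1 : L.GenSpace) := by
  simp [monomial]

namespace MaslovPotential

@[simp] theorem wordDegree_nil : mu.wordDegree [] = 0 := rfl

@[simp] theorem wordDegree_cons (a : L.Generator) (w : List L.Generator) :
    mu.wordDegree (a :: w) = mu.degree a + mu.wordDegree w := by
  simp [wordDegree]

@[simp] theorem wordDegree_append (v w : List L.Generator) :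
    mu.wordDegree (v ++ w) = mu.wordDegree v + mu.wordDegree w := by
  simp [wordDegree]

theorem monomial_mem_grading (w : List L.Generator) :
    monomial w ∈ mu.grading (mu.wordDegree w) :=
  Submodule.subset_span ⟨w, rfl, rfl⟩

theorem ι_mem_grading (a : L.Generator) :
    TensorAlgebra.ι (ZMod 2) (Finsupp.single a 1 : L.GenSpace) ∈ mu.grading (mu.degree a) := by
  simpa [monomial_singleton] using mu.monomial_mem_grading [a]

instance gradedMonoid_grading : SetLike.GradedMonoid mu.grading where
  one_mem := mu.monomial_mem_grading []
  mul_mem := by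
    intro i j u v hu hv
    have h : mu.grading i * mu.grading j ≤ mu.grading (i + j) := by
      rw [grading, grading, Submodule.span_mul_span, Submodule.span_le]
      rintro _ ⟨_, ⟨w, rfl, rfl⟩, _, ⟨w', rfl, rfl⟩, rfl⟩
      have := mu.monomial_mem_grading (w ++ w')
      rwa [wordDegree_append, monomial_append] at this
    exact h (Submodule.mul_mem_mul hu hv)

open scoped DirectSum in
/-- The algebra map that decomposes an element of the tensor algebra into its homogeneous parts. -/
def decomposeAlgHom : L.Alg →ₐ[ZMod 2] ⨁ k, mu.grading k :=
  TensorAlgebra.lift (ZMod 2) (Finsupp.linearCombination (ZMod 2) fun a =>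
    DirectSum.of (fun k => mu.grading k) (mu.degree a) ⟨_, mu.ι_mem_grading a⟩)

theorem decomposeAlgHom_monomial (w : List L.Generator) :
    mu.decomposeAlgHom (monomial w) =
      DirectSum.of (fun k => mu.grading k) _ ⟨_, mu.monomial_mem_grading w⟩ := by
  induction w with
  | nil => exact map_one _
  | cons a w ih =>
    refine (map_mul mu.decomposeAlgHom (TensorAlgebra.ι (ZMod 2) (Finsupp.single a 1))
      (monomial w)).trans ?_
    rw [ih, decomposeAlgHom, TensorAlgebra.lift_ι_apply, Finsupp.linearCombination_single, one_smul,
      DirectSum.of_mul_of]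
    rfl

theorem nonempty_gradedAlgebra : Nonempty (GradedAlgebra mu.grading) := by
  refine ⟨GradedAlgebra.ofAlgHom mu.grading mu.decomposeAlgHom ?_ ?_⟩
  · ext a
    simp [decomposeAlgHom]
  · rintro k ⟨u, hu⟩
    induction hu using Submodule.span_induction with
    | mem u hu =>
      obtain ⟨w, rfl, rfl⟩ := hu
      exact mu.decomposeAlgHom_monomial w
    | zero => exact (map_zero _).trans (map_zero (DirectSum.of _ k)).symm
    | add u v hu hv ihu ihv =>
      exact (map_add _ _ _).trans ((congrArg₂ _ ihu ihv).trans (map_add (DirectSum.of _ k) _ _).symm)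
    | smul c u hu ih =>
      exact (map_smul _ _ _).trans ((congrArg _ ih).trans
        (map_smul (DirectSum.lof (ZMod 2) ℤ (fun k => mu.grading k) k) _ _).symm)

/-- A derivation that lowers the degree of the generators by one lowers all degrees by one. -/
theorem map_mem_grading {d : L.Alg →ₗ[ZMod 2] L.Alg} (hd : ∀ u v, d (u * v) = d u * v + u * d v)
    (h : ∀ a, d (TensorAlgebra.ι (ZMod 2) (Finsupp.single a 1 : L.GenSpace)) ∈
      mu.grading (mu.degree a - 1)) (k : ℤ) :
    ∀ u ∈ mu.grading k, d u ∈ mu.grading (k - 1) := by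
  have hw : ∀ w, d (monomial w) ∈ mu.grading (mu.wordDegree w - 1) := by
    intro w
    induction w with
    | nil =>
      have := TensorAlgebra.map_algebraMap_of_leibniz hd 1
      rw [map_one] at this
      rw [monomial_nil, this]
      exact zero_mem _
    | cons a w ih =>
      rw [monomial_cons, hd]
      refine add_mem ?_ ?_
      · have := SetLike.mul_mem_graded (h a) (mu.monomial_mem_grading w)
        rwa [show mu.degree a - 1 + mu.wordDegree w = mu.wordDegree (a :: w) - 1 by
          rw [wordDegree_cons]; ring] at this
      · have := SetLike.mul_mem_graded (mu.ι_mem_grading a) ih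
        rwa [show mu.degree a + (mu.wordDegree w - 1) = mu.wordDegree (a :: w) - 1 by
          rw [wordDegree_cons]; ring] at this
  have : mu.grading k ≤ (mu.grading (k - 1)).comap d := by
    refine Submodule.span_le.2 ?_
    rintro _ ⟨w, rfl, rfl⟩
    exact hw w
  exact this

end MaslovPotential
end LegendrianKnot

/-! ### Sums over chord paths -/

namespace LegendrianKnot

variable {L : LegendrianKnot} {mu : L.MaslovPotential}

namespace LabeledLines

theorem X_lt_X (V : L.LabeledLines) {m n : ℕ} (hm : 1 ≤ m) (hmn : m < n) (hn : n ≤ V.M) :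
    V.X m < V.X n := by
  induction n, hmn using Nat.le_induction with
  | base => exact V.X_lt m hm (by omega)
  | succ n hmn ih => exact (ih (by omega)).trans (V.X_lt n (by omega) (by omega))

theorem Between.lt {V : L.LabeledLines} {m n : ℕ} {u v : ℝ} (hu : V.Between m u)
    (hv : V.Between n v) (hmn : m < n) (hn : n ≤ V.M) : u < v := by
  have h1 := hu.2 (by omega)
  have h2 := hv.1 (by omega)
  rcases Nat.eq_or_lt_of_le (Nat.succ_le_of_lt hmn) with h | h
  · subst h
    exact h1.trans h2
  · exact h1.trans ((V.X_lt_X (by omega) h hn).trans h2)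

theorem Between.index_eq {V : L.LabeledLines} {m n : ℕ} {u : ℝ} (hm : V.Between m u)
    (hn : V.Between n u) (hmM : m ≤ V.M) (hnM : n ≤ V.M) : m = n := by
  rcases lt_trichotomy m n with h | h | h
  · exact absurd (hm.lt hn h hnM) (lt_irrefl u)
  · exact h
  · exact absurd (hn.lt hm h hmM) (lt_irrefl u)

end LabeledLines

namespace MCS

variable (C : L.MCS mu)

/-- The chord paths with convex corners that start with the chord `r`, each together with the
crossing at which it terminates. -/
def pathsFrom (r : Chord) : Set (List Chord × L.Crossing) :=
  {p | (∀ q ∈ p.1, C.IsChord q) ∧ p.1.IsChain C.Step ∧ p.1.head? = some r ∧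
    ∃ q, p.1.getLast? = some q ∧ C.IsTerminating q p.2}

/-- The possible terminal crossings for the chord `r`. -/
def terminals (r : Chord) : Set L.Crossing := {b | C.IsTerminating r b}

theorem pathsFrom_of_not_isChord {r : Chord} (hr : ¬ C.IsChord r) : C.pathsFrom r = ∅ := by
  ext ⟨Λ, b⟩
  simp only [pathsFrom, Set.mem_ofPred_eq, Set.mem_empty_iff_false, iff_false]
  rintro ⟨h, -, h', -⟩
  exact hr (h r (List.mem_of_mem_head? h'))

/-- A chord path either consists of its first chord only, or continues with a second chord. -/
theorem pathsFrom_eq {r : Chord} (hr : C.IsChord r) :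
    C.pathsFrom r = (fun b => ([r], b)) '' C.terminals r ∪
      ⋃ r' ∈ {r' | C.Step r r'}, (fun p => (r :: p.1, p.2)) '' C.pathsFrom r' := by
  ext ⟨Λ, b⟩
  simp only [pathsFrom, terminals, Set.mem_union, Set.mem_iUnion, Set.mem_image, Set.mem_ofPred_eq,
    Prod.mk.injEq, Prod.exists, exists_prop]
  constructor
  · rintro ⟨h1, h2, h3, q, h4, h5⟩
    match Λ with
    | [] => simp at h3
    | [r0] =>
      obtain rfl : r0 = r := by simpa using h3
      obtain rfl : r0 = q := by simpa using h4
      exact Or.inl ⟨b, h5, rfl, rfl⟩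
    | r0 :: r1 :: Λ =>
      obtain rfl : r0 = r := by simpa using h3
      rw [List.isChain_cons_cons] at h2
      refine Or.inr ⟨r1, h2.1, r1 :: Λ, b, ⟨?_, h2.2, rfl, q, ?_, h5⟩, rfl, rfl⟩
      · exact fun q hq => h1 q (List.mem_cons_of_mem _ hq)
      · simpa using h4
  · rintro (⟨b, hb, rfl, rfl⟩ | ⟨r', hr', Λ, b, ⟨h1, h2, h3, q, h4, h5⟩, rfl, rfl⟩)
    · exact ⟨by simpa using hr, List.isChain_singleton _, rfl, r, rfl, hb⟩
    · match Λ with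
      | [] => simp at h3
      | r0 :: Λ =>
        obtain rfl : r0 = r' := by simpa using h3
        refine ⟨?_, List.isChain_cons_cons.2 ⟨hr', h2⟩, rfl, q, by simpa using h4, h5⟩
        rintro q (_ | ⟨_, hq⟩)
        exacts [hr, h1 q hq]

theorem terminals_subsingleton (r : Chord) : (C.terminals r).Subsingleton := by
  rintro b ⟨p, k, h1, h2, -⟩ b' ⟨p', k', h1', h2', -⟩
  obtain rfl : p = p' := by omega
  rw [h2] at h2'
  cases h2'
  rfl

theorem finite_isChord : {r : Chord | C.IsChord r}.Finite := by
  refine Set.Finite.subset ((Set.finite_le_nat C.M).biUnion fun m _ =>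
    ((Set.finite_le_nat (C.s m)).prod (Set.finite_le_nat (C.s m))).image
      fun p : ℕ × ℕ => (⟨m, p.1, p.2⟩ : Chord)) ?_
  rintro ⟨m, i, j⟩ ⟨-, h2, -, h4, h5⟩
  dsimp only at *
  exact Set.mem_biUnion h2 ⟨(i, j), ⟨(h4.trans_le h5).le, h5⟩, rfl⟩

theorem finite_pathsFrom (r : Chord) : (C.pathsFrom r).Finite := by
  induction hm : r.m generalizing r with
  | zero =>
    rw [C.pathsFrom_of_not_isChord fun h => by have := h.1; omega]
    exact Set.finite_empty
  | succ m ih =>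
    by_cases hr : C.IsChord r
    · rw [C.pathsFrom_eq hr]
      refine ((C.terminals_subsingleton r).finite.image _).union ?_
      have : (⋃ r' ∈ {r' | C.Step r r'}, (fun p => (r :: p.1, p.2)) '' C.pathsFrom r') ⊆
          ⋃ r' ∈ {r' | C.Step r r'} ∩ {r' | C.IsChord r'},
            (fun p => (r :: p.1, p.2)) '' C.pathsFrom r' := by
        intro p hp
        simp only [Set.mem_iUnion, Set.mem_image] at hp ⊢
        obtain ⟨r', h1, q, h2, h3⟩ := hp
        refine ⟨r', ⟨h1, ?_⟩, q, h2, h3⟩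
        by_contra h
        rw [C.pathsFrom_of_not_isChord h] at h2
        exact h2
      refine Set.Finite.subset ?_ this
      refine Set.Finite.biUnion (C.finite_isChord.subset Set.inter_subset_right) fun r' h => ?_
      exact (ih r' (by have := h.1.1; omega)).image _
    · rw [C.pathsFrom_of_not_isChord hr]
      exact Set.finite_empty

/-- The sum of the words of all chord paths that start with the chord `r`. -/
def pathSum (r : Chord) : L.Alg := ∑ᶠ p ∈ C.pathsFrom r, monomial (C.word p.2 p.1)

theorem pathSum_of_not_isChord {r : Chord} (hr : ¬ C.IsChord r) : C.pathSum r = 0 := by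
  rw [pathSum, C.pathsFrom_of_not_isChord hr, finsum_mem_empty]

/-- The contributions to `pathSum r` of the paths consisting of `r` only, and of those that
continue with a given second chord. -/
theorem pathSum_eq {r : Chord} (hr : C.IsChord r) (hf : {r' | C.Step r r'}.Finite) :
    C.pathSum r = (∑ᶠ b ∈ C.terminals r, monomial [.inl b]) +
      ∑ᶠ r' ∈ {r' | C.Step r r'},
        monomial (C.topCorner r r') * C.pathSum r' * monomial (C.bottomCorner r r') := by
  have hinj : ∀ s : Set (List Chord × L.Crossing),
      s.InjOn (fun p : List Chord × L.Crossing => (r :: p.1, p.2)) := by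
    rintro s ⟨Λ, b⟩ - ⟨Λ', b'⟩ - h
    simpa using h
  have hhead : ∀ r' p, p ∈ C.pathsFrom r' → ∃ Λ, p = (r' :: Λ, p.2) := by
    rintro r' ⟨Λ, b⟩ ⟨-, -, h3, -⟩
    match Λ with
    | [] => simp at h3
    | r0 :: Λ =>
      obtain rfl : r0 = r' := by simpa using h3
      exact ⟨Λ, rfl⟩
  rw [pathSum, C.pathsFrom_eq hr, finsum_mem_union, finsum_mem_image, finsum_mem_biUnion _ hf]
  · congr 1
    refine finsum_mem_congr rfl fun r' _ => ?_
    rw [finsum_mem_image (hinj _), pathSum, finsum_mem_eq_finite_toFinset_sum _ (C.finite_pathsFrom r'),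
      finsum_mem_eq_finite_toFinset_sum _ (C.finite_pathsFrom r'), Finset.mul_sum, Finset.sum_mul]
    refine Finset.sum_congr rfl fun p hp => ?_
    obtain ⟨Λ, hΛ⟩ := hhead r' p (by simpa using hp)
    rw [hΛ]
    simp only [word, monomial_append]
  · exact fun r' _ => (C.finite_pathsFrom r').image _
  · rintro r1 - r2 - h12
    refine Set.disjoint_left.2 ?_
    rintro _ ⟨p, hp, rfl⟩ ⟨q, hq, h⟩
    obtain ⟨Λ, hΛ⟩ := hhead r1 p hp
    obtain ⟨Λ', hΛ'⟩ := hhead r2 q hq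
    rw [hΛ, hΛ'] at h
    simp only [Prod.mk.injEq, List.cons.injEq] at h
    exact h12 h.1.2.1.symm
  · rintro b - b' - h
    simpa using h
  · refine Set.disjoint_left.2 ?_
    rintro _ ⟨b, hb, rfl⟩ h
    simp only [Set.mem_iUnion, Set.mem_image] at h
    obtain ⟨r', -, p, hp, h⟩ := h
    obtain ⟨Λ, hΛ⟩ := hhead r' p hp
    rw [hΛ] at h
    simp at h
  · exact (C.terminals_subsingleton r).finite.image _
  · exact hf.biUnion fun r' _ => (C.finite_pathsFrom r').image _

end MCS
end LegendrianKnot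

/-! ### Chord paths and elementary tangles -/

theorem finsum_mem_eq_and {α M : Type*} [AddCommMonoid M] (f : α → M) (a : α) (P : Prop)
    [Decidable P] : ∑ᶠ x ∈ {x | x = a ∧ P}, f x = if P then f a else 0 := by
  by_cases h : P <;> simp [h]

theorem finsum_mem_or_or {α M : Type*} [AddCommMonoid M] (f : α → M) {a b c : α} {P Q R : Prop}
    [Decidable P] [Decidable Q] [Decidable R] (hab : P → Q → a ≠ b) (hac : P → R → a ≠ c)
    (hbc : Q → R → b ≠ c) :
    ∑ᶠ x ∈ {x | (x = a ∧ P) ∨ (x = b ∧ Q) ∨ (x = c ∧ R)}, f x =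
      (if P then f a else 0) + ((if Q then f b else 0) + if R then f c else 0) := by
  have hfin : ∀ (a : α) (P : Prop), {x | x = a ∧ P}.Finite := fun a P =>
    (Set.finite_singleton a).subset fun x hx => hx.1
  have h1 : Disjoint {x | x = b ∧ Q} {x | x = c ∧ R} := by
    refine Set.disjoint_left.2 ?_
    rintro x ⟨rfl, h⟩ ⟨h', h''⟩
    exact hbc h h'' h'
  have h2 : Disjoint {x | x = a ∧ P} ({x | x = b ∧ Q} ∪ {x | x = c ∧ R}) := by
    refine Set.disjoint_left.2 ?_
    rintro x ⟨rfl, h⟩ (⟨h', h''⟩ | ⟨h', h''⟩)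
    exacts [hab h h'' h', hac h h'' h']
  have h3 : {x | (x = a ∧ P) ∨ (x = b ∧ Q) ∨ (x = c ∧ R)} =
      {x | x = a ∧ P} ∪ ({x | x = b ∧ Q} ∪ {x | x = c ∧ R}) := rfl
  rw [h3, finsum_mem_union h2 (hfin _ _) ((hfin _ _).union (hfin _ _)),
    finsum_mem_union h1 (hfin _ _) (hfin _ _), finsum_mem_eq_and, finsum_mem_eq_and,
    finsum_mem_eq_and]

namespace LegendrianKnot

variable {L : LegendrianKnot} {mu : L.MaslovPotential}

namespace MCS

variable (C : L.MCS mu)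

/-- The labels at a crossing. -/
theorem crossing_bounds {m k : ℕ} {c : L.Crossing} (hm : m ≤ C.M) (h : C.tangle m = .crossing c k) :
    1 ≤ m ∧ 1 ≤ k ∧ k + 1 ≤ C.s m ∧ C.s (m + 1) = C.s m ∧ m + 1 ≤ C.M := by
  have h1 := C.elementary m hm
  rw [h] at h1
  obtain ⟨-, -, h2, h3, h4, -⟩ := h1
  have h0 : m ≠ 0 := by
    rintro rfl
    have := C.s_zero
    omega
  have hM : m ≠ C.M := by
    rintro rfl
    have := C.s_last
    omega
  omega

theorem handleslide_bounds {m k l : ℕ} {g : HandleslideMark mu} (hm : m ≤ C.M)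
    (h : C.tangle m = .handleslide g k l) : 1 ≤ k ∧ k < l ∧ l ≤ C.s m ∧ C.s (m + 1) = C.s m := by
  have h1 := C.elementary m hm
  rw [h] at h1
  obtain ⟨-, -, h2, h3, h4, h5, -⟩ := h1
  exact ⟨h3, h4, h5, h2⟩

theorem rightCusp_bounds {m k : ℕ} {c : {c : L.Cusp // c.IsRight}} (hm : m ≤ C.M)
    (h : C.tangle m = .rightCusp c k) :
    1 ≤ m ∧ k = L.strandsAbove c.1.t + 1 ∧ k + 1 ≤ C.s m ∧ C.s m = C.s (m + 1) + 2 := by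
  have h1 := C.elementary m hm
  rw [h] at h1
  obtain ⟨-, -, h2, h3, h4, -⟩ := h1
  refine ⟨?_, h3, h4, h2⟩
  rcases Nat.eq_zero_or_pos m with rfl | h
  · have := C.s_zero
    omega
  · exact h

theorem terminals_eq_empty {m i j : ℕ} (h : ∀ b k, C.tangle m ≠ .crossing b k) :
    C.terminals ⟨m + 1, i, j⟩ = ∅ := by
  refine Set.eq_empty_of_forall_notMem ?_
  rintro b ⟨p, k, h1, h2, -⟩
  obtain rfl : m = p := by simpa using h1
  exact h b k h2

theorem pathSum_leftCusp {m k : ℕ} {c : {c : L.Cusp // c.IsLeft}} (h : C.tangle m = .leftCusp c k)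
    (i j : ℕ) : C.pathSum ⟨m + 1, i, j⟩ = 0 := by
  by_cases hr : C.IsChord ⟨m + 1, i, j⟩
  · have hs : {r' | C.Step ⟨m + 1, i, j⟩ r'} = ∅ := by
      refine Set.eq_empty_of_forall_notMem ?_
      rintro ⟨m', i', j'⟩ ⟨h1, h2⟩
      obtain rfl : m' = m := by simpa using h1
      simp [h] at h2
    rw [C.pathSum_eq hr (hs ▸ Set.finite_empty), hs, C.terminals_eq_empty (by simp [h]),
      finsum_mem_empty, finsum_mem_empty, add_zero]
  · exact C.pathSum_of_not_isChord hr

theorem pathSum_rightCusp {m k i j : ℕ} {c : {c : L.Cusp // c.IsRight}}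
    (h : C.tangle m = .rightCusp c k) (hr : C.IsChord ⟨m + 1, i, j⟩) :
    C.pathSum ⟨m + 1, i, j⟩ = C.pathSum ⟨m, skip k i, skip k j⟩ := by
  have hs : {r' | C.Step ⟨m + 1, i, j⟩ r'} = {⟨m, skip k i, skip k j⟩} := by
    ext ⟨m', i', j'⟩
    simp only [Step, Set.mem_ofPred_eq, Set.mem_singleton_iff, Chord.mk.injEq,
      Nat.add_right_cancel_iff]
    refine and_congr_right ?_
    rintro rfl
    simp [h]
  rw [C.pathSum_eq hr (hs ▸ Set.finite_singleton _), hs, C.terminals_eq_empty (by simp [h]),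
    finsum_mem_empty, finsum_mem_singleton]
  simp [topCorner, bottomCorner, h]

theorem pathSum_handleslide {m k l i j : ℕ} {g : HandleslideMark mu} (hm : m ≤ C.M)
    (h : C.tangle m = .handleslide g k l) (hr : C.IsChord ⟨m + 1, i, j⟩) :
    C.pathSum ⟨m + 1, i, j⟩ = C.pathSum ⟨m, i, j⟩ + (if i = k then C.pathSum ⟨m, l, j⟩ else 0) +
      if j = l then C.pathSum ⟨m, i, k⟩ else 0 := by
  obtain ⟨-, hkl, -, -⟩ := C.handleslide_bounds hm h
  have hs : {r' | C.Step ⟨m + 1, i, j⟩ r'} = {r' | (r' = ⟨m, i, j⟩ ∧ True) ∨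
      (r' = ⟨m, l, j⟩ ∧ (i = k ∧ l < j)) ∨ (r' = ⟨m, i, k⟩ ∧ (j = l ∧ i < k))} := by
    ext ⟨m', i', j'⟩
    simp only [Step, Set.mem_ofPred_eq, Chord.mk.injEq, Nat.add_right_cancel_iff]
    by_cases hm' : m' = m
    · subst hm'
      simp only [h, true_and]
      tauto
    · simp [hm']
  have hf : {r' | C.Step ⟨m + 1, i, j⟩ r'}.Finite := by
    rw [hs]
    refine Set.Finite.subset (Set.toFinite {⟨m, i, j⟩, ⟨m, l, j⟩, ⟨m, i, k⟩}) ?_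
    rintro r' (h | h | h) <;> simp [h.1]
  rw [C.pathSum_eq hr hf, hs, C.terminals_eq_empty (by simp [h]), finsum_mem_empty,
    finsum_mem_or_or]
  · have h1 : ¬ l < j → C.pathSum ⟨m, l, j⟩ = 0 := fun h =>
      C.pathSum_of_not_isChord fun h' => h h'.2.2.2.1
    have h2 : ¬ i < k → C.pathSum ⟨m, i, k⟩ = 0 := fun h =>
      C.pathSum_of_not_isChord fun h' => h h'.2.2.2.1
    by_cases h3 : l < j <;> by_cases h4 : i < k <;>
      simp [topCorner, bottomCorner, h, h1, h2, h3, h4, add_assoc]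
  · simp only [ne_eq, Chord.mk.injEq]; omega
  · simp only [ne_eq, Chord.mk.injEq]; omega
  · simp only [ne_eq, Chord.mk.injEq]; omega

theorem pathSum_crossing {m k i j : ℕ} {c : L.Crossing}
    (h : C.tangle m = .crossing c k) (hr : C.IsChord ⟨m + 1, i, j⟩) :
    C.pathSum ⟨m + 1, i, j⟩ =
      (if (j = k ∧ (C.complex m).coeff i k = 1) ∨ (i = k + 1 ∧ (C.complex m).coeff (k + 1) j = 1)
        then monomial [.inl c] else 0) +
      (C.pathSum ⟨m, Equiv.swap k (k + 1) i, Equiv.swap k (k + 1) j⟩ +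
      ((if j = k then C.pathSum ⟨m, i, k⟩ * monomial [.inl c] else 0) +
      if i = k + 1 then monomial [.inl c] * C.pathSum ⟨m, k + 1, j⟩ else 0)) := by
  obtain ⟨-, -, -, hij, -⟩ := id hr
  dsimp only at hij
  have hs : {r' | C.Step ⟨m + 1, i, j⟩ r'} = {r' |
      (r' = ⟨m, Equiv.swap k (k + 1) i, Equiv.swap k (k + 1) j⟩ ∧ True) ∨
      (r' = ⟨m, i, k⟩ ∧ j = k) ∨ (r' = ⟨m, k + 1, j⟩ ∧ i = k + 1)} := by
    ext ⟨m', i', j'⟩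
    simp only [Step, Set.mem_ofPred_eq, Chord.mk.injEq, Nat.add_right_cancel_iff]
    by_cases hm' : m' = m
    · subst hm'
      simp only [h, true_and]
      tauto
    · simp [hm']
  have hf : {r' | C.Step ⟨m + 1, i, j⟩ r'}.Finite := by
    rw [hs]
    refine Set.Finite.subset (Set.toFinite
      {⟨m, Equiv.swap k (k + 1) i, Equiv.swap k (k + 1) j⟩, ⟨m, i, k⟩, ⟨m, k + 1, j⟩}) ?_
    rintro r' (h | h | h) <;> simp [h.1]
  have ht : C.terminals ⟨m + 1, i, j⟩ = {b | b = c ∧ ((j = k ∧ (C.complex m).coeff i k = 1) ∨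
      (i = k + 1 ∧ (C.complex m).coeff (k + 1) j = 1))} := by
    ext b
    simp only [terminals, IsTerminating, Set.mem_ofPred_eq, Nat.add_right_cancel_iff]
    constructor
    · rintro ⟨p, k', rfl, h2, h3⟩
      rw [h] at h2
      cases h2
      exact ⟨rfl, h3⟩
    · rintro ⟨rfl, h3⟩
      exact ⟨m, k, rfl, h, h3⟩
  rw [C.pathSum_eq hr hf, hs, ht, finsum_mem_eq_and, finsum_mem_or_or]
  · congr 1
    rw [if_pos trivial]
    congr 1
    · simp only [topCorner, bottomCorner, h]
      rw [if_neg, if_neg, monomial_nil, one_mul, mul_one]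
      · rintro ⟨rfl, h⟩
        simp at h
      · rintro ⟨rfl, h⟩
        simp at h
    · congr 1
      · by_cases hj : j = k
        · have hi : i ≠ k + 1 := by omega
          simp [hj, hi, topCorner, bottomCorner, h]
        · simp [hj]
      · by_cases hi : i = k + 1
        · have hj : j ≠ k := by omega
          simp [hi, hj, topCorner, bottomCorner, h]
        · simp [hi]
  · simp only [ne_eq, Chord.mk.injEq]
    rintro - rfl h
    simp at h
  · simp only [ne_eq, Chord.mk.injEq]
    rintro - rfl h
    simp at h
  · simp only [ne_eq, Chord.mk.injEq]; omega

end MCS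
end LegendrianKnot

/-! ### Degrees of words -/

namespace LegendrianKnot

variable {L : LegendrianKnot} {mu : L.MaslovPotential}

theorem deriv_x_add_int (t : ℝ) (n : ℤ) : deriv L.x (t + n) = deriv L.x t := by
  have h : (fun u => L.x (u + n)) = L.x := funext fun u => by
    simpa using L.periodic_x.int_mul n u
  rw [← deriv_comp_add_const, h]

/-- The Maslov potential is constant along an arc without cusps. -/
theorem Joined.μ_eq {p q : ℝ} (h : L.Joined p q) (hq : deriv L.x q ≠ 0) : mu.μ p = mu.μ q := by
  obtain ⟨n, hn⟩ := h
  have h1 : ∀ u ∈ Set.uIcc p (q + n), deriv L.x u ≠ 0 := fun u hu h0 => by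
    rw [hn u hu h0, deriv_x_add_int] at h0
    exact hq h0
  have h2 : mu.μ (q + n) = mu.μ q := by simpa using mu.periodic.int_mul n q
  rw [← h2]
  rcases le_total p (q + n) with h | h
  · exact mu.eq_of_no_cusp _ _ h fun u hu => h1 u (Set.Icc_subset_uIcc hu)
  · exact (mu.eq_of_no_cusp _ _ h fun u hu => h1 u (Set.Icc_subset_uIcc' hu)).symm

theorem IsGenericFront.deriv_x_ne_zero (hL : L.IsGenericFront) (c : L.Crossing) :
    deriv L.x c.T ≠ 0 ∧ deriv L.x c.B ≠ 0 := by
  have key : ∀ t ∈ Set.Ico (0 : ℝ) 1, L.x t = L.x c.T → deriv L.x t ≠ 0 := fun t ht hx h => by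
    have := @hL.xCoord_injective (.inr ⟨t, ht, h⟩) (.inl c) hx
    cases this
  exact ⟨key _ c.T_mem rfl, key _ c.B_mem c.x_eq.symm⟩

theorem LabeledLines.deriv_x_ne_zero (V : L.LabeledLines) {m i : ℕ} (hm : 1 ≤ m) (hm' : m ≤ V.M)
    (hi : 1 ≤ i) (hi' : i ≤ V.s m) : deriv L.x (V.pt m i) ≠ 0 := fun h =>
  V.avoids m (.inr ⟨_, V.pt_mem m i hm hm' hi hi', h⟩) hm hm' (V.x_pt m i hm hm' hi hi')

namespace MCS

variable (C : L.MCS mu)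

/-- The degree of the `i`-th strand over `x = X m`. -/
def strandDegree (m i : ℕ) : ℤ := mu.μ (C.pt m i)

/-- The degree of a chord: the difference of the Maslov potentials of its ends. -/
def chordDegree (r : Chord) : ℤ := C.strandDegree r.m r.i - C.strandDegree r.m r.j

theorem strandDegree_crossing {m k : ℕ} {c : L.Crossing} (hL : L.IsGenericFront) (hm : m ≤ C.M)
    (h : C.tangle m = .crossing c k) :
    (∀ i, 1 ≤ i → i ≤ C.s m → C.strandDegree (m + 1) i =
      C.strandDegree m (Equiv.swap k (k + 1) i)) ∧
    C.strandDegree m k - C.strandDegree m (k + 1) = mu.degree (.inl c) := by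
  obtain ⟨hm1, hk, hks, hs, hmM⟩ := C.crossing_bounds hm h
  have h1 := C.elementary m hm
  rw [h] at h1
  obtain ⟨-, -, -, -, -, h5, h6, h7⟩ := h1
  constructor
  · intro i hi hi'
    have h8 : 1 ≤ Equiv.swap k (k + 1) i ∧ Equiv.swap k (k + 1) i ≤ C.s m := by
      rw [Equiv.swap_apply_def]
      split_ifs <;> omega
    have := h5 _ h8.1 h8.2
    rw [Equiv.swap_apply_self] at this
    exact (this.μ_eq (C.deriv_x_ne_zero (by omega) hmM hi (by omega))).symm
  · exact congrArg₂ _ (h6.μ_eq (hL.deriv_x_ne_zero c).1) (h7.μ_eq (hL.deriv_x_ne_zero c).2)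

theorem strandDegree_rightCusp {m k : ℕ} {c : {c : L.Cusp // c.IsRight}} (hm : m ≤ C.M)
    (h : C.tangle m = .rightCusp c k) {i : ℕ} (hi : 1 ≤ i) (hi' : i ≤ C.s (m + 1)) :
    C.strandDegree (m + 1) i = C.strandDegree m (skip k i) := by
  obtain ⟨hm1, -, hks, hs⟩ := C.rightCusp_bounds hm h
  have h1 := C.elementary m hm
  rw [h] at h1
  obtain ⟨-, -, -, -, -, h5, -⟩ := h1
  refine (h5 i hi hi').μ_eq (C.deriv_x_ne_zero hm1 hm ?_ ?_) <;>
  · rw [skip]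
    split_ifs <;> omega

theorem strandDegree_handleslide {m k l : ℕ} {g : HandleslideMark mu} (hm1 : 1 ≤ m)
    (hmM : m + 1 ≤ C.M) (h : C.tangle m = .handleslide g k l) :
    (∀ i, 1 ≤ i → i ≤ C.s m → C.strandDegree (m + 1) i = C.strandDegree m i) ∧
    C.strandDegree m k = C.strandDegree m l := by
  obtain ⟨hk, hkl, hl, hs⟩ := C.handleslide_bounds (by omega) h
  have h1 := C.elementary m (by omega)
  rw [h] at h1
  obtain ⟨hb, h2, -, -, -, -, h5, h6, h7⟩ := h1
  constructor
  · intro i hi hi'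
    exact ((h5 i hi hi').μ_eq (C.deriv_x_ne_zero (by omega) hmM hi (by omega))).symm
  · have key : ∀ t ∈ Set.Ico (0 : ℝ) 1, L.x t = L.x g.top → deriv L.x t ≠ 0 := fun t ht hx h0 =>
      h2 (.inr ⟨t, ht, h0⟩) (by rwa [← hx] at hb)
    exact (h6.μ_eq (key _ g.top_mem rfl)).trans
      (g.μ_eq.trans (h7.μ_eq (key _ g.bot_mem g.x_eq.symm)).symm)

theorem chordDegree_of_isOriginating (hL : L.IsGenericFront) {r : Chord} {a : L.Generator}
    (hr : C.IsChord r) (h : C.IsOriginating r a) : C.chordDegree r = mu.degree a := by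
  obtain ⟨m, i, j⟩ := r
  have hm : m ≤ C.M := hr.2.1
  have hc := C.compatible m hm
  unfold IsOriginating at h
  dsimp only at h
  generalize hT : C.tangle m = T at h hc
  cases T with
  | crossing c k =>
    obtain ⟨rfl, rfl, rfl⟩ := h
    exact (C.strandDegree_crossing hL hm hT).2
  | rightCusp c k =>
    obtain ⟨rfl, rfl, rfl⟩ := h
    -- the degrees of the strands at a right cusp differ by one, as `d_m` connects them
    have h2 := (C.complex m).degree i (i + 1) (by rw [hc.1]; exact one_ne_zero)
    simp only [chordDegree, strandDegree, MaslovPotential.degree, h2]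
    ring
  | leftCusp c k => exact h.elim
  | handleslide g k l => exact h.elim

theorem chordDegree_of_isTerminating (hL : L.IsGenericFront) {r : Chord} {b : L.Crossing}
    (hr : C.IsChord r) (h : C.IsTerminating r b) :
    mu.degree (.inl b) = C.chordDegree r - 1 := by
  obtain ⟨m, i, j⟩ := r
  obtain ⟨p, k, hm, hT, h⟩ := h
  obtain ⟨hr1, hr2, hr3, hr4, hr5⟩ := hr
  dsimp only at *
  subst hm
  obtain ⟨hm1, hk, hks, hs, hmM⟩ := C.crossing_bounds (by omega) hT
  obtain ⟨h1, h2⟩ := C.strandDegree_crossing hL (by omega) hT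
  rw [chordDegree, h1 i hr3 (by omega), h1 j (by omega) (by omega), ← h2]
  rcases h with ⟨rfl, h⟩ | ⟨rfl, h⟩
  · have h3 := (C.complex p).degree _ _ (by rw [h]; exact one_ne_zero)
    rw [Equiv.swap_apply_left, Equiv.swap_apply_of_ne_of_ne (by omega) (by omega)]
    simp only [strandDegree, h3]
    ring
  · have h3 := (C.complex p).degree _ _ (by rw [h]; exact one_ne_zero)
    rw [Equiv.swap_apply_right, Equiv.swap_apply_of_ne_of_ne (by omega) (by omega)]
    simp only [strandDegree, h3]
    ring

theorem chordDegree_of_step (hL : L.IsGenericFront) {r r' : Chord} (hr : C.IsChord r)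
    (hr' : C.IsChord r') (h : C.Step r r') :
    C.chordDegree r = mu.wordDegree (C.topCorner r r') + C.chordDegree r' +
      mu.wordDegree (C.bottomCorner r r') := by
  obtain ⟨m, i, j⟩ := r
  obtain ⟨m', i', j'⟩ := r'
  obtain ⟨hr1, hr2, hr3, hr4, hr5⟩ := hr
  obtain ⟨hr1', hr2', hr3', hr4', hr5'⟩ := hr'
  obtain ⟨hm, h⟩ := h
  dsimp only at *
  subst hm
  simp only [topCorner, bottomCorner, chordDegree]
  generalize hT : C.tangle m' = T at h
  cases T with
  | crossing c k =>
    obtain ⟨hm1, hk, hks, hs, hmM⟩ := C.crossing_bounds hr2' hT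
    obtain ⟨h1, h2⟩ := C.strandDegree_crossing hL hr2' hT
    rw [h1 i hr3 (by omega), h1 j (by omega) (by omega)]
    dsimp only
    rcases h with ⟨rfl, rfl⟩ | ⟨rfl, rfl, rfl⟩ | ⟨rfl, rfl, rfl⟩
    · rw [if_neg, if_neg, MaslovPotential.wordDegree_nil]
      · ring
      · rintro ⟨rfl, h⟩
        simp at h
      · rintro ⟨rfl, h⟩
        simp at h
    · rw [if_neg (by omega), if_pos ⟨rfl, rfl⟩, Equiv.swap_apply_left,
        Equiv.swap_apply_of_ne_of_ne (by omega) (by omega)]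
      simp only [MaslovPotential.wordDegree_cons, MaslovPotential.wordDegree_nil, ← h2]
      ring
    · rw [if_pos ⟨rfl, rfl⟩, if_neg (by omega), Equiv.swap_apply_right,
        Equiv.swap_apply_of_ne_of_ne (by omega) (by omega)]
      simp only [MaslovPotential.wordDegree_cons, MaslovPotential.wordDegree_nil, ← h2]
      ring
  | rightCusp c k =>
    obtain ⟨rfl, rfl⟩ := h
    rw [C.strandDegree_rightCusp hr2' hT hr3 (by omega),
      C.strandDegree_rightCusp hr2' hT (by omega) hr5]
    simp
  | leftCusp c k => exact h.elim
  | handleslide g k l =>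
    obtain ⟨hk, hkl, hl, hs⟩ := C.handleslide_bounds hr2' hT
    obtain ⟨h1, h2⟩ := C.strandDegree_handleslide hr1' hr2 hT
    rw [h1 i hr3 (by omega), h1 j (by omega) (by omega)]
    rcases h with ⟨rfl, rfl⟩ | ⟨rfl, -, rfl, rfl⟩ | ⟨rfl, -, rfl, rfl⟩ <;> simp [h2]

/-- A word of a chord path has degree one less than the initial chord: each convex corner takes
its degree away from the chord, and `⟨d e_i, e_j⟩ = 1` at the end accounts for the one. -/
theorem wordDegree_of_mem_pathsFrom (hL : L.IsGenericFront) {r : Chord}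
    {p : List Chord × L.Crossing} (hp : p ∈ C.pathsFrom r) :
    mu.wordDegree (C.word p.2 p.1) = C.chordDegree r - 1 := by
  obtain ⟨Λ, b⟩ := p
  obtain ⟨h1, h2, h3, q, h4, h5⟩ := hp
  dsimp only at *
  induction Λ generalizing r with
  | nil => simp at h3
  | cons r0 Λ ih =>
    obtain rfl : r0 = r := by simpa using h3
    match Λ with
    | [] =>
      obtain rfl : r0 = q := by simpa using h4
      simp [word, C.chordDegree_of_isTerminating hL (h1 r0 (by simp)) h5]
    | r1 :: Λ =>
      rw [List.isChain_cons_cons] at h2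
      have ih := ih (r := r1) (fun q hq => h1 q (List.mem_cons_of_mem _ hq)) h2.2 rfl
        (by simpa using h4)
      rw [word, MaslovPotential.wordDegree_append, MaslovPotential.wordDegree_append, ih,
        C.chordDegree_of_step hL (h1 r0 (by simp)) (h1 r1 (by simp)) h2.1]
      ring

end MCS
end LegendrianKnot

/-! ### The differential of a generator -/

namespace LegendrianKnot

variable {L : LegendrianKnot} {mu : L.MaslovPotential}

namespace MCS

variable (C : L.MCS mu)

/-- The chord paths with convex corners that begin at the generator `a`, each together with the
crossing at which it terminates. -/
def genPaths (a : L.Generator) : Set (List Chord × L.Crossing) :=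
  {p | C.IsChordPath p.1 a p.2}

/-- A generator has at most one originating chord. -/
theorem eq_of_isOriginating {r r' : Chord} {a : L.Generator} (hr : C.IsChord r)
    (hr' : C.IsChord r') (h : C.IsOriginating r a) (h' : C.IsOriginating r' a) : r = r' := by
  obtain ⟨m, i, j⟩ := r
  obtain ⟨m', i', j'⟩ := r'
  have hm : m ≤ C.M := hr.2.1
  have hm' : m' ≤ C.M := hr'.2.1
  have he := C.elementary m hm
  have he' := C.elementary m' hm'
  have hmm : m = m' → (⟨m, i, j⟩ : Chord) = ⟨m', i', j'⟩ := by
    rintro rfl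
    unfold IsOriginating at h h'
    dsimp only at h h'
    generalize C.tangle m = T at h h'
    cases T with
    | crossing c k => simp [h.2, h'.2]
    | rightCusp c k => simp [h.2, h'.2]
    | leftCusp c k => exact h.elim
    | handleslide g k l => exact h.elim
  unfold IsOriginating at h h'
  dsimp only at h h'
  generalize C.tangle m = T at h he
  generalize C.tangle m' = T' at h' he'
  cases T <;> cases T' <;> try exact h.elim
  all_goals try exact h'.elim
  · obtain ⟨rfl, -⟩ := h
    obtain ⟨h1, -⟩ := h'
    cases h1
    exact hmm (he.1.index_eq he'.1 hm hm')
  · exact absurd (h.1.symm.trans h'.1) (by simp)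
  · exact absurd (h.1.symm.trans h'.1) (by simp)
  · obtain ⟨rfl, -⟩ := h
    obtain ⟨h1, -⟩ := h'
    cases h1
    exact hmm (he.1.index_eq he'.1 hm hm')

theorem genPaths_eq {r : Chord} {a : L.Generator} (hr : C.IsChord r) (h : C.IsOriginating r a) :
    C.genPaths a = C.pathsFrom r := by
  ext ⟨Λ, b⟩
  constructor
  · rintro ⟨h1, h2, ⟨r', h3, h4⟩, h5⟩
    obtain rfl := C.eq_of_isOriginating hr (h1 r' (List.mem_of_mem_head? h3)) h h4
    exact ⟨h1, h2, h3, h5⟩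
  · rintro ⟨h1, h2, h3, h5⟩
    exact ⟨h1, h2, ⟨r, h3, h⟩, h5⟩

theorem exists_of_mem_genPaths {a : L.Generator} {p : List Chord × L.Crossing}
    (hp : p ∈ C.genPaths a) : ∃ r, C.IsChord r ∧ C.IsOriginating r a := by
  obtain ⟨h1, -, ⟨r, h3, h4⟩, -⟩ := hp
  exact ⟨r, h1 r (List.mem_of_mem_head? h3), h4⟩

theorem finite_genPaths (a : L.Generator) : (C.genPaths a).Finite := by
  rcases (C.genPaths a).eq_empty_or_nonempty with h | ⟨p, hp⟩
  · exact h ▸ Set.finite_empty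
  · obtain ⟨r, h1, h2⟩ := C.exists_of_mem_genPaths hp
    exact C.genPaths_eq h1 h2 ▸ C.finite_pathsFrom r

theorem chordPaths_eq (a : L.Generator) (w : List L.Generator) :
    C.chordPaths a w = Prod.fst '' {p ∈ C.genPaths a | C.word p.2 p.1 = w} := by
  ext Λ
  constructor
  · rintro ⟨b, h1, h2⟩
    exact ⟨(Λ, b), ⟨h1, h2⟩, rfl⟩
  · rintro ⟨⟨Λ, b⟩, ⟨h1, h2⟩, rfl⟩
    exact ⟨b, h1, h2⟩

theorem finite_iUnion_chordPaths (a : L.Generator) : (⋃ w, C.chordPaths a w).Finite := by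
  refine ((C.finite_genPaths a).image Prod.fst).subset (Set.iUnion_subset fun w => ?_)
  rw [chordPaths_eq]
  exact Set.image_mono (Set.sep_subset _ _)

/-- A chord path determines the crossing at which it terminates. -/
theorem injOn_fst_genPaths (a : L.Generator) : (C.genPaths a).InjOn Prod.fst := by
  rintro ⟨Λ, b⟩ ⟨-, -, -, r, h1, h2⟩ ⟨Λ', b'⟩ ⟨-, -, -, r', h1', h2'⟩ h
  dsimp only at *
  subst h
  rw [h1] at h1'
  cases h1'
  rw [C.terminals_subsingleton r h2 h2']

theorem wordDegree_of_mem_genPaths (hL : L.IsGenericFront) {a : L.Generator}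
    {p : List Chord × L.Crossing} (hp : p ∈ C.genPaths a) :
    mu.wordDegree (C.word p.2 p.1) = mu.degree a - 1 := by
  obtain ⟨r, h1, h2⟩ := C.exists_of_mem_genPaths hp
  rw [C.genPaths_eq h1 h2] at hp
  rw [C.wordDegree_of_mem_pathsFrom hL hp, C.chordDegree_of_isOriginating hL h1 h2]

theorem one_le_length_word (b : L.Crossing) (Λ : List Chord) : 1 ≤ (C.word b Λ).length := by
  induction Λ with
  | nil => simp [word]
  | cons r Λ ih =>
    match Λ with
    | [] => simp [word]
    | r' :: Λ =>
      rw [word, List.length_append, List.length_append]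
      omega

/-- The sum of the words of all chord paths that begin at the generator `a`. -/
def genDiff (a : L.Generator) : L.Alg := ∑ᶠ p ∈ C.genPaths a, monomial (C.word p.2 p.1)

theorem genDiff_eq {r : Chord} {a : L.Generator} (hr : C.IsChord r) (h : C.IsOriginating r a) :
    C.genDiff a = C.pathSum r := by
  rw [genDiff, C.genPaths_eq hr h, pathSum]

theorem genDiff_eq_zero {a : L.Generator} (h : ∀ r, C.IsChord r → ¬ C.IsOriginating r a) :
    C.genDiff a = 0 := by
  rw [genDiff, Set.eq_empty_of_forall_notMem (s := C.genPaths a), finsum_mem_empty]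
  intro p hp
  obtain ⟨r, h1, h2⟩ := C.exists_of_mem_genPaths hp
  exact h r h1 h2

theorem genDiff_mem_grading (hL : L.IsGenericFront) (a : L.Generator) :
    C.genDiff a ∈ mu.grading (mu.degree a - 1) := by
  rw [genDiff, finsum_mem_eq_finite_toFinset_sum _ (C.finite_genPaths a)]
  refine sum_mem fun p hp => ?_
  rw [← C.wordDegree_of_mem_genPaths hL ((Set.Finite.mem_toFinset _).1 hp)]
  exact mu.monomial_mem_grading _

open Classical in
/-- The degree condition in the definition of `dn` is automatic, since all words of chord paths
that begin at `a` have degree `|a| - 1`. -/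
theorem dn_single (hL : L.IsGenericFront) (n : ℕ) (a : L.Generator) :
    C.dn n (Finsupp.single a 1) = ∑ p ∈ (C.finite_genPaths a).toFinset,
      if (C.word p.2 p.1).length = n then monomial (C.word p.2 p.1) else 0 := by
  set S := (C.finite_genPaths a).toFinset with hS
  have hcard : ∀ w, (C.chordPaths a w).ncard = (S.filter fun p => C.word p.2 p.1 = w).card := by
    intro w
    rw [chordPaths_eq, ((C.injOn_fst_genPaths a).mono (Set.sep_subset _ _)).ncard_image, ← Set.ncard_coe_finset]
    congr 1
    ext p
    simp [hS]
  rw [dn, Finsupp.linearCombination_single, one_smul]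
  have h1 : ∀ w : List L.Generator,
      (∑ᶠ (_ : w.length = n ∧ mu.wordDegree w = mu.degree a - 1),
        ((C.chordPaths a w).ncard : ZMod 2) • (monomial w : L.Alg)) =
      (S.filter fun p => C.word p.2 p.1 = w).card •
        (if w.length = n then (monomial w : L.Alg) else 0) := by
    intro w
    rw [hcard, Nat.cast_smul_eq_nsmul]
    by_cases hn : w.length = n
    · by_cases hd : mu.wordDegree w = mu.degree a - 1
      · simp [hn, hd]
      · rw [Finset.card_eq_zero.2, zero_smul, zero_smul, finsum_zero]
        refine Finset.filter_eq_empty_iff.2 ?_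
        rintro p hp rfl
        exact hd (C.wordDegree_of_mem_genPaths hL ((Set.Finite.mem_toFinset _).1 hp))
    · simp [hn]
  simp only [h1]
  rw [Finset.sum_comp (fun w => if w.length = n then (monomial w : L.Alg) else 0)
    (fun p : List Chord × L.Crossing => C.word p.2 p.1)]
  refine finsum_eq_sum_of_support_subset _ fun w hw => ?_
  rw [Function.mem_support] at hw
  by_contra h
  refine hw ?_
  rw [Finset.card_eq_zero.2, zero_smul]
  refine Finset.filter_eq_empty_iff.2 ?_
  rintro p hp rfl
  exact h (by simpa using ⟨p.1, p.2, hp, rfl⟩)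

/-- The linear extension of `genDiff`. -/
def genMap : L.GenSpace →ₗ[ZMod 2] L.Alg := Finsupp.linearCombination (ZMod 2) C.genDiff

theorem genMap_single (a : L.Generator) : C.genMap (Finsupp.single a 1) = C.genDiff a := by
  rw [genMap, Finsupp.linearCombination_single, one_smul]

theorem finite_and_finsum_dn_single (hL : L.IsGenericFront) (a : L.Generator) :
    (Function.support fun n => C.dn n (Finsupp.single a 1)).Finite ∧
      ∑ᶠ n, C.dn n (Finsupp.single a 1) = C.genDiff a := by
  classical
  simp only [C.dn_single hL]
  have h : ∀ p : List Chord × L.Crossing, (Function.support fun n =>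
      if (C.word p.2 p.1).length = n then (monomial (C.word p.2 p.1) : L.Alg) else 0).Finite :=
    fun p => (Set.finite_singleton (C.word p.2 p.1).length).subset fun n hn => by
      by_contra h'
      exact hn (if_neg fun h => h' h.symm)
  constructor
  · refine Set.Finite.subset ((C.finite_genPaths a).toFinset.finite_toSet.biUnion
      fun p _ => h p) fun n hn => ?_
    obtain ⟨p, hp, hp'⟩ := Finset.exists_ne_zero_of_sum_ne_zero hn
    exact Set.mem_biUnion hp hp'
  · rw [finsum_sum_comm _ _ fun p _ => h p, genDiff,
      finsum_mem_eq_finite_toFinset_sum _ (C.finite_genPaths a)]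
    refine Finset.sum_congr rfl fun p _ => ?_
    rw [finsum_eq_single _ (C.word p.2 p.1).length fun n hn => if_neg hn.symm, if_pos rfl]

theorem dn_zero (hL : L.IsGenericFront) : C.dn 0 = 0 := by
  classical
  refine Finsupp.lhom_ext' fun a => LinearMap.ext_ring ?_
  refine (C.dn_single hL 0 a).trans (Finset.sum_eq_zero fun p _ => if_neg ?_)
  have := C.one_le_length_word p.2 p.1
  omega

theorem finsum_dn (hL : L.IsGenericFront) (v : L.GenSpace) :
    ∑ᶠ (n : ℕ) (_ : 1 ≤ n), C.dn n v = C.genMap v := by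
  have h0 : ∀ n : ℕ, ∑ᶠ (_ : 1 ≤ n), C.dn n v = C.dn n v := by
    intro n
    rcases Nat.eq_zero_or_pos n with rfl | hn
    · simp [C.dn_zero hL]
    · exact finsum_eq_if.trans (if_pos hn)
  simp only [h0]
  clear h0
  suffices h : (Function.support fun n => C.dn n v).Finite ∧ ∑ᶠ n, C.dn n v = C.genMap v from h.2
  induction v using Finsupp.induction_linear with
  | zero => simp [Function.support]
  | add v w hv hw =>
    simp only [map_add]
    exact ⟨(hv.1.union hw.1).subset (Function.support_add _ _),
      by rw [finsum_add_distrib hv.1 hw.1, hv.2, hw.2]⟩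
  | single a c =>
    have hc : (Finsupp.single a c : L.GenSpace) = c • Finsupp.single a 1 := by simp
    obtain ⟨h1, h2⟩ := C.finite_and_finsum_dn_single hL a
    simp only [hc, map_smul]
    exact ⟨h1.subset (Function.support_const_smul_subset c _),
      by rw [← smul_finsum' c h1, h2, genMap_single]⟩

end MCS
end LegendrianKnot

/-! ### Coefficients of complexes related by the elementary tangles -/

theorem coeffMap_single (s : ℕ) (c : ℕ → ℕ → ZMod 2) (i j : ℕ) (a : ZMod 2) :
    coeffMap s c (Finsupp.single i a) j = if j ∈ Finset.Icc 1 s then a * c i j else 0 := by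
  rw [coeffMap, Finsupp.linearCombination_single, Finsupp.smul_apply, Finsupp.finsetSum_apply]
  simp [Finsupp.single_apply]

theorem single_mem_chains {s i : ℕ} (hi : i ∈ Finset.Icc 1 s) :
    (Finsupp.single i 1 : ChainSpace) ∈ chains s :=
  Submodule.subset_span ⟨i, by simpa using hi, rfl⟩

theorem handleslideMap_apply {k l : ℕ} (hkl : k ≠ l) (v : ChainSpace) (j : ℕ) :
    handleslideMap k l v j = v j + if j = l then v k else 0 := by
  induction v using Finsupp.induction_linear with
  | zero => simp
  | add v w hv hw =>
    rw [map_add, Finsupp.add_apply, hv, hw]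
    split_ifs <;> simp only [Finsupp.add_apply, add_zero]
    abel
  | single i a =>
    rw [handleslideMap, Finsupp.linearCombination_single]
    simp only [Finsupp.single_apply, Finsupp.smul_apply, smul_eq_mul]
    split_ifs <;> simp_all

namespace OrderedComplex

variable {s s' : ℕ} {deg deg' : ℕ → ℤ} (K : OrderedComplex s deg) (K' : OrderedComplex s' deg')

theorem coeff_eq_zero {i j : ℕ} (h : ¬ i < j) : K.coeff i j = 0 :=
  of_not_not fun h' => h (K.triangular i j h').2.1

theorem d_single (i j : ℕ) : K.d (Finsupp.single i 1) j = K.coeff i j := by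
  rw [d, coeffMap_single, one_mul]
  refine (ite_eq_left_iff).2 fun h => (of_not_not fun h' => h ?_)
  have := K.triangular i j (Ne.symm h')
  exact Finset.mem_Icc.2 ⟨by omega, this.2.2⟩

theorem sum_coeff_mul_coeff (i j : ℕ) :
    ∑ p ∈ Finset.Icc 1 s, K.coeff i p * K.coeff p j = 0 := by
  have h : K.d (K.d (Finsupp.single i 1)) j = 0 :=
    DFunLike.congr_fun (LinearMap.congr_fun K.sq_zero (Finsupp.single i 1)) j
  by_cases hj : j ∈ Finset.Icc 1 s
  · rw [← h]
    have h1 : K.d (Finsupp.single i 1) =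
        ∑ p ∈ Finset.Icc 1 s, Finsupp.single p (K.coeff i p) := by
      rw [d, coeffMap, Finsupp.linearCombination_single, one_smul]
    rw [h1, map_sum, Finsupp.finsetSum_apply]
    refine Finset.sum_congr rfl fun p _ => ?_
    rw [d, coeffMap_single, if_pos hj]
  · refine Finset.sum_eq_zero fun p _ => ?_
    rw [of_not_not (a := K.coeff p j = 0) fun h' => hj ?_, mul_zero]
    have := K.triangular p j h'
    exact Finset.mem_Icc.2 ⟨by omega, this.2.2⟩

theorem coeff_of_relabel (σ : Equiv.Perm ℕ)
    (h : IsComplexIso (chains s) K.d (chains s') K'.d (relabel σ)) {i : ℕ}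
    (hi : i ∈ Finset.Icc 1 s) (j : ℕ) : K'.coeff (σ i) (σ j) = K.coeff i j := by
  have h1 := DFunLike.congr_fun (h.comm _ (single_mem_chains hi)) (σ j)
  rw [relabel, Finsupp.lmapDomain_apply, Finsupp.lmapDomain_apply, Finsupp.mapDomain_single,
    d_single, Finsupp.mapDomain_apply σ.injective, d_single] at h1
  exact h1.symm

/-- In coordinates, a handleslide replaces `D` by `(1 + N) D (1 + N)`, with `N` the matrix whose
only entry is in position `(k, l)`. -/
theorem coeff_of_handleslide {k l : ℕ} (hkl : k < l)
    (h : IsComplexIso (chains s) K.d (chains s') K'.d (handleslideMap k l))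
    (hl : l ∈ Finset.Icc 1 s) {i : ℕ} (hi : i ∈ Finset.Icc 1 s) (j : ℕ) :
    K'.coeff i j = K.coeff i j + (if i = k then K.coeff l j else 0) +
      if j = l then K.coeff i k else 0 := by
  have key : ∀ i ∈ Finset.Icc 1 s, ∀ j, K.coeff i j + (if j = l then K.coeff i k else 0) =
      K'.coeff i j + if i = k then K'.coeff l j else 0 := by
    intro i hi j
    have h1 := DFunLike.congr_fun (h.comm _ (single_mem_chains hi)) j
    rw [handleslideMap_apply hkl.ne, d_single, d_single] at h1
    rw [h1, handleslideMap, Finsupp.linearCombination_single, one_smul]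
    split_ifs with hik
    · rw [map_add, Finsupp.add_apply, d_single, d_single, hik]
    · rw [d_single, add_zero]
  have h1 := key i hi j
  have h2 := key l hl j
  rw [K.coeff_eq_zero (i := l) (j := k) (by omega), if_neg hkl.ne'] at h2
  have h3 : K'.coeff l j = K.coeff l j := by simpa using h2.symm
  rw [h3] at h1
  rw [add_right_comm, h1, add_assoc, CharTwo.add_self_eq_zero, add_zero]

end OrderedComplex

/-! ### The Maurer–Cartan equation for chord path sums -/

namespace LegendrianKnot

variable {L : LegendrianKnot} {mu : L.MaslovPotential}

instance charP_alg : CharP L.Alg 2 :=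
  charP_of_injective_algebraMap (TensorAlgebra.algebraMap_leftInverse (R := ZMod 2) L.GenSpace).injective 2

namespace MCS

variable (C : L.MCS mu)

/-- The differential of the tensor algebra. -/
def diff : L.Alg →ₗ[ZMod 2] L.Alg := TensorAlgebra.derivOf C.genMap

theorem diff_mul (u v : L.Alg) : C.diff (u * v) = C.diff u * v + u * C.diff v :=
  TensorAlgebra.derivOf_mul _ u v

theorem diff_algebraMap (c : ZMod 2) : C.diff (algebraMap (ZMod 2) L.Alg c) = 0 :=
  TensorAlgebra.map_algebraMap_of_leibniz C.diff_mul c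

theorem diff_ι (v : L.GenSpace) : C.diff (TensorAlgebra.ι (ZMod 2) v) = C.genMap v :=
  TensorAlgebra.derivOf_ι _ v

theorem diff_monomial_singleton (a : L.Generator) : C.diff (monomial [a]) = C.genDiff a := by
  rw [monomial_singleton, diff_ι, genMap_single]

/-- The strictly upper triangular matrix at the line `x = X m` obtained by adding the matrix of
`d_m` to the matrix of sums over chord paths. -/
def connection (m i j : ℕ) : L.Alg :=
  algebraMap (ZMod 2) L.Alg ((C.complex m).coeff i j) + C.pathSum ⟨m, i, j⟩

theorem pathSum_eq_zero {m i j : ℕ} (h : ¬ i < j) : C.pathSum ⟨m, i, j⟩ = 0 :=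
  C.pathSum_of_not_isChord fun h' => h h'.2.2.2.1

theorem connection_eq_zero {m i j : ℕ} (h : ¬ i < j) : C.connection m i j = 0 := by
  rw [connection, (C.complex m).coeff_eq_zero h, C.pathSum_eq_zero h, map_zero, add_zero]

theorem sum_connection_succ (m k : ℕ) (S : Finset ℕ) :
    ∑ p ∈ S, C.connection m k p * C.connection m p (k + 1) = 0 := by
  refine Finset.sum_eq_zero fun p _ => ?_
  rcases Nat.lt_or_ge k p with h | h
  · rw [C.connection_eq_zero (i := p) (by omega), mul_zero]
  · rw [C.connection_eq_zero (j := p) (by omega), zero_mul]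

theorem isChord_of_mem {m i j : ℕ} (hm1 : 1 ≤ m) (hm : m ≤ C.M) (hi : i ∈ Finset.Icc 1 (C.s m))
    (hj : j ∈ Finset.Icc 1 (C.s m)) (hij : i < j) : C.IsChord ⟨m, i, j⟩ :=
  ⟨hm1, hm, (Finset.mem_Icc.1 hi).1, hij, (Finset.mem_Icc.1 hj).2⟩

theorem connection_handleslide {m k l : ℕ} {g : HandleslideMark mu} (hm : m + 1 ≤ C.M)
    (h : C.tangle m = .handleslide g k l) {i j : ℕ} (hi : i ∈ Finset.Icc 1 (C.s m))
    (hj : j ∈ Finset.Icc 1 (C.s m)) :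
    C.connection (m + 1) i j = C.connection m i j +
      (if i = k then C.connection m l j else 0) + if j = l then C.connection m i k else 0 := by
  obtain ⟨hk, hkl, hl, hs⟩ := C.handleslide_bounds (by omega) h
  have hc := C.compatible m (by omega)
  rw [h] at hc
  by_cases hij : i < j
  · rw [connection, C.pathSum_handleslide (by omega) h
      (C.isChord_of_mem (by omega) hm (hs ▸ hi) (hs ▸ hj) hij),
      (C.complex m).coeff_of_handleslide _ hkl hc (Finset.mem_Icc.2 ⟨by omega, hl⟩) hi j]
    simp only [connection]
    split_ifs <;> simp only [map_add, map_zero] <;> abel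
  · rw [C.connection_eq_zero hij, C.connection_eq_zero hij]
    split_ifs
    · rw [C.connection_eq_zero (by omega), C.connection_eq_zero (by omega)]
      simp
    · rw [C.connection_eq_zero (by omega)]
      simp
    · rw [C.connection_eq_zero (by omega)]
      simp
    · simp

/-- Across a crossing `b` the matrix undergoes the gauge transformation by `b` in position
`(k, k + 1)` followed by the exchange of the strands `k` and `k + 1`. -/
theorem connection_crossing {m k : ℕ} {c : L.Crossing} (hm : m + 1 ≤ C.M)
    (h : C.tangle m = .crossing c k) {i j : ℕ} (hi : i ∈ Finset.Icc 1 (C.s m))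
    (hj : j ∈ Finset.Icc 1 (C.s m)) {i' j' : ℕ} (hi' : i' = Equiv.swap k (k + 1) i)
    (hj' : j' = Equiv.swap k (k + 1) j) :
    C.connection (m + 1) i j = C.connection m i' j' +
      (if i' = k then monomial [.inl c] * C.connection m (k + 1) j' else 0) +
      (if j' = k + 1 then C.connection m i' k * monomial [.inl c] else 0) +
      if i' = k then if j' = k + 1 then C.connection m k (k + 1) else 0 else 0 := by
  obtain ⟨hm1, hk, hks, hs, hmM⟩ := C.crossing_bounds (by omega) h
  have hc := C.compatible m (by omega)
  rw [h] at hc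
  rw [Equiv.swap_apply_def] at hi' hj'
  have hiff : i' = k ↔ i = k + 1 := by
    rw [hi']
    split_ifs <;> omega
  have hjff : j' = k + 1 ↔ j = k := by
    rw [hj']
    split_ifs <;> omega
  -- the words of length one of terminating chords are the products of `b` with entries of `D`
  have hb : ∀ x : ZMod 2, (if x = 1 then monomial [.inl c] else 0 : L.Alg) =
      algebraMap (ZMod 2) L.Alg x * monomial [.inl c] ∧
      (if x = 1 then monomial [.inl c] else 0 : L.Alg) =
      monomial [.inl c] * algebraMap (ZMod 2) L.Alg x := by
    intro x
    obtain rfl | rfl := (by decide : ∀ x : ZMod 2, x = 0 ∨ x = 1) x <;> simp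
  simp only [hiff, hjff]
  -- the chord `[k, k + 1]` needs no separate treatment: its transposed ends do not form a chord
  by_cases hij : i < j
  · have hcoeff : (C.complex (m + 1)).coeff i j = (C.complex m).coeff i' j' := by
      have := (C.complex m).coeff_of_relabel _ _ hc.2 (i := i')
        (Finset.mem_Icc.2 ?_) j'
      · rw [← this, hi', hj', ← Equiv.swap_apply_def, ← Equiv.swap_apply_def,
          Equiv.swap_apply_self, Equiv.swap_apply_self]
      · rw [Finset.mem_Icc] at hi
        rw [hi']
        split_ifs <;> omega
    rw [connection, C.pathSum_crossing h
      (C.isChord_of_mem (by omega) hm (hs ▸ hi) (hs ▸ hj) hij), hcoeff, Equiv.swap_apply_def,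
      Equiv.swap_apply_def, ← hi', ← hj']
    by_cases hjk : j = k
    · have hik : i ≠ k + 1 := by omega
      have hi'' : i' = i := by
        rw [hi', if_neg (by omega), if_neg hik]
      simp only [hjk, hik, hi'', true_and, false_and, or_false, if_true, if_false, connection,
        (hb _).1, add_mul]
      abel
    · by_cases hik : i = k + 1
      · have hj'' : j' = j := by
          rw [hj', if_neg (by omega), if_neg (by omega)]
        simp only [hjk, hik, hj'', true_and, false_and, false_or, if_true, if_false, connection,
          (hb _).2, mul_add]
        abel
      · simp [hjk, hik, connection]
  · rw [C.connection_eq_zero hij]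
    by_cases hjk : j = k
    · by_cases hik : i = k + 1
      · rw [hjff.2 hjk, hiff.2 hik, if_pos hik, if_pos hjk, if_pos hik, if_pos hjk,
          C.connection_eq_zero (lt_irrefl (k + 1)), C.connection_eq_zero (lt_irrefl k), mul_zero,
          zero_mul, add_zero, add_zero, CharTwo.add_self_eq_zero]
      · have : k + 1 ≤ i' := by
          rw [hi']
          split_ifs <;> omega
        rw [if_neg hik, if_pos hjk, if_neg hik, hjff.2 hjk, C.connection_eq_zero (by omega),
          C.connection_eq_zero (by omega)]
        simp
    · by_cases hik : i = k + 1
      · have : j' ≤ k := by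
          rw [hj']
          split_ifs <;> omega
        rw [if_pos hik, if_neg hjk, if_pos hik, if_neg hjk, hiff.2 hik,
          C.connection_eq_zero (by omega), C.connection_eq_zero (by omega)]
        simp
      · rw [if_neg hik, if_neg hjk, if_neg hik, C.connection_eq_zero]
        · simp
        · rw [hi', hj']
          split_ifs <;> omega

/-- The Maurer–Cartan equation at all lines without right cusps to their left. It propagates from
left to right. -/
theorem isMaurerCartan_connection {m : ℕ} (hm : m ≤ C.M)
    (h : ∀ p < m, ∀ c k, C.tangle p ≠ .rightCusp c k) :
    IsMaurerCartan C.diff (C.s m) (C.connection m) := by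
  induction m with
  | zero =>
    intro i hi
    simp [C.s_zero] at hi
  | succ m ih =>
    have ih := ih (by omega) fun p hp => h p (by omega)
    have h' := h m (by omega)
    generalize hT : C.tangle m = T at h'
    cases T with
    | rightCusp c k => exact absurd rfl (h' c k)
    | leftCusp c k =>
      have h1 : ∀ i j, C.connection (m + 1) i j =
          algebraMap (ZMod 2) L.Alg ((C.complex (m + 1)).coeff i j) := fun i j => by
        rw [connection, C.pathSum_leftCusp hT, add_zero]
      intro i _ j _
      simp only [h1, C.diff_algebraMap, ← map_mul, ← map_sum,
        (C.complex (m + 1)).sum_coeff_mul_coeff, map_zero]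
    | handleslide g k l =>
      obtain ⟨hk, hkl, hl, hs⟩ := C.handleslide_bounds (by omega) hT
      rw [hs]
      have hd : C.diff 1 = 0 := by simpa using C.diff_algebraMap 1
      refine (IsMaurerCartan.gauge (d := C.diff.toAddMonoidHom) C.diff_mul ih
        (Finset.mem_Icc.2 ⟨hk, by omega⟩) (Finset.mem_Icc.2 ⟨by omega, hl⟩) hkl.ne
        (C.connection_eq_zero (by omega)) (b := 1) ?_).congr fun i hi j hj => ?_
      · simp [hd]
      · rw [C.connection_handleslide hm hT hi hj]
        simp [hd]
    | crossing c k =>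
      obtain ⟨hm1, hk, hks, hs, -⟩ := C.crossing_bounds (by omega) hT
      have hk1 : k ∈ Finset.Icc 1 (C.s m) := Finset.mem_Icc.2 ⟨hk, by omega⟩
      have hk2 : k + 1 ∈ Finset.Icc 1 (C.s m) := Finset.mem_Icc.2 ⟨by omega, hks⟩
      have hc := C.compatible m (by omega)
      rw [hT] at hc
      have hd : C.diff (monomial [.inl c]) = C.connection m k (k + 1) := by
        rw [diff_monomial_singleton, C.genDiff_eq (r := ⟨m, k, k + 1⟩)
          (C.isChord_of_mem hm1 (by omega) hk1 hk2 k.lt_succ_self), connection, hc.1, map_zero,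
          zero_add]
        simp [IsOriginating, hT]
      rw [hs]
      refine ((IsMaurerCartan.gauge (d := C.diff.toAddMonoidHom) C.diff_mul ih hk1 hk2
        k.lt_succ_self.ne (C.connection_eq_zero (by omega)) (b := monomial [.inl c]) ?_).relabel
        (Equiv.swap k (k + 1)) ?_).congr fun i hi j hj => ?_
      · change C.diff (C.diff (monomial [.inl c])) = 0
        rw [hd, ih k hk1 (k + 1) hk2, sum_connection_succ]
      · intro i
        rw [Finset.mem_Icc, Finset.mem_Icc, Equiv.swap_apply_def]
        split_ifs <;> omega
      · rw [C.connection_crossing hm hT hi hj rfl rfl, ← hd]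
        rfl

/-- The sum over the chord paths that start with a chord between consecutive strands is a cycle,
where the Maurer–Cartan equation holds. -/
theorem diff_pathSum_succ {m : ℕ} (hm : m ≤ C.M)
    (h : ∀ p < m, ∀ c k, C.tangle p ≠ .rightCusp c k) (k : ℕ) :
    C.diff (C.pathSum ⟨m, k, k + 1⟩) = 0 := by
  by_cases hr : C.IsChord ⟨m, k, k + 1⟩
  · obtain ⟨-, -, h1, -, h2⟩ := hr
    dsimp only at *
    have h3 := C.isMaurerCartan_connection hm h k (Finset.mem_Icc.2 ⟨h1, by omega⟩) (k + 1)
      (Finset.mem_Icc.2 ⟨by omega, h2⟩)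
    rwa [sum_connection_succ, connection, map_add, diff_algebraMap, zero_add] at h3
  · rw [C.pathSum_of_not_isChord hr, map_zero]

/-- As the front is nearly plat, there are no right cusps to the left of a crossing. -/
theorem tangle_ne_rightCusp (hL : L.IsNearlyPlat) {m k : ℕ} {c : L.Crossing} (hm : m ≤ C.M)
    (h : C.tangle m = .crossing c k) : ∀ p < m, ∀ c k, C.tangle p ≠ .rightCusp c k := by
  intro p hp c' k' h'
  have h1 := C.elementary m hm
  have h2 := C.elementary p (by omega)
  rw [h] at h1
  rw [h'] at h2
  exact lt_asymm (hL.crossing_lt_right c c'.1 c'.2) (h2.1.lt h1.1 hp hm)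

/-- To the right of the crossings the strands come in consecutive pairs `(k, k + 1)` with `k` odd,
and chord paths starting at a chord between paired strands lead, through right cusps and
handleslides, to such a chord at the last line to the left of the right cusps. -/
theorem diff_pathSum_odd (hL : L.IsNearlyPlat) {m : ℕ} (hm : m ≤ C.M) {k : ℕ} (hk : Odd k) :
    C.diff (C.pathSum ⟨m, k, k + 1⟩) = 0 := by
  induction m generalizing k with
  | zero => exact C.diff_pathSum_succ hm (by simp) k
  | succ m ih =>
    by_cases hr : C.IsChord ⟨m + 1, k, k + 1⟩
    swap
    · rw [C.pathSum_of_not_isChord hr, map_zero]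
    generalize hT : C.tangle m = T
    cases T with
    | leftCusp c l => rw [C.pathSum_leftCusp hT, map_zero]
    | rightCusp c l =>
      obtain ⟨n, hn⟩ := hL.not_nested c.1
      obtain ⟨-, hl, -⟩ := C.rightCusp_bounds (by omega) hT
      obtain ⟨q, rfl⟩ := hk
      rw [C.pathSum_rightCusp hT hr]
      have h1 : skip l (2 * q + 1 + 1) = skip l (2 * q + 1) + 1 := by
        rw [skip, skip]
        split_ifs <;> omega
      -- both `k` and the label `l` of the cusp are odd, so the cusp is not between the two strands
      rw [h1]
      refine ih (by omega) ?_
      rw [skip]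
      split_ifs
      exacts [⟨q, rfl⟩, ⟨q + 1, by ring⟩]
    | handleslide g l n =>
      obtain ⟨-, hln, -⟩ := C.handleslide_bounds (by omega) hT
      rw [C.pathSum_handleslide (by omega) hT hr]
      have h2 : (if k = l then C.pathSum ⟨m, n, k + 1⟩ else 0) = 0 := by
        split_ifs
        exacts [C.pathSum_eq_zero (by omega), rfl]
      have h3 : (if k + 1 = n then C.pathSum ⟨m, k, l⟩ else 0) = 0 := by
        split_ifs
        exacts [C.pathSum_eq_zero (by omega), rfl]
      rw [h2, h3, add_zero, add_zero]
      exact ih (by omega) hk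
    | crossing c l =>
      refine C.diff_pathSum_succ hm (fun p hp c' k' h' => ?_) k
      rcases Nat.lt_succ_iff_lt_or_eq.1 hp with h | rfl
      · exact C.tangle_ne_rightCusp hL (by omega) hT p h c' k' h'
      · rw [hT] at h'
        cases h'

theorem diff_genDiff (hL : L.IsNearlyPlat) (a : L.Generator) : C.diff (C.genDiff a) = 0 := by
  by_cases h : ∃ r, C.IsChord r ∧ C.IsOriginating r a
  · obtain ⟨⟨m, i, j⟩, hr, ha⟩ := h
    have hm : m ≤ C.M := hr.2.1
    rw [C.genDiff_eq hr ha]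
    unfold IsOriginating at ha
    dsimp only at ha
    generalize hT : C.tangle m = T at ha
    cases T with
    | crossing c k =>
      obtain ⟨-, rfl, rfl⟩ := ha
      exact C.diff_pathSum_succ hm (C.tangle_ne_rightCusp hL hm hT) i
    | rightCusp c k =>
      obtain ⟨-, rfl, rfl⟩ := ha
      obtain ⟨-, hk, -⟩ := C.rightCusp_bounds hm hT
      exact C.diff_pathSum_odd hL hm (hk ▸ (hL.not_nested c.1).add_one)
    | leftCusp c k => exact ha.elim
    | handleslide g k l => exact ha.elim
  · rw [C.genDiff_eq_zero fun r hr ha => h ⟨r, hr, ha⟩, map_zero]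

/-- The square of a derivation is a derivation over `ℤ/2`, so that it suffices to consider the
generators. -/
theorem diff_comp_diff (hL : L.IsNearlyPlat) : C.diff ∘ₗ C.diff = 0 := by
  refine TensorAlgebra.eq_of_leibniz (fun u v => ?_) (by simp) fun v => ?_
  · have h : ∀ x : L.Alg, x + x = 0 := CharTwo.add_self_eq_zero
    simp only [LinearMap.comp_apply, C.diff_mul, map_add]
    -- the two mixed terms `d u * d v` cancel in characteristic two
    grind
  · rw [LinearMap.comp_apply, diff_ι, LinearMap.zero_apply]
    induction v using Finsupp.induction_linear with
    | zero => simp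
    | add v w hv hw => rw [map_add, map_add, hv, hw, add_zero]
    | single a c =>
      rw [genMap, Finsupp.linearCombination_single, map_smul, C.diff_genDiff hL, smul_zero]

end MCS
end LegendrianKnot
end

/-! ### The differential graded algebra of a Morse complex sequence -/

theorem theorem5p2 (L : LegendrianKnot) (hL : L.IsNearlyPlat) (mu : L.MaslovPotential)
    (C : L.MCS mu) :
    -- only finitely many chord paths with convex corners begin at a given generator
    (∀ a, (⋃ w, C.chordPaths a w).Finite) ∧
    -- the tensor algebra is a graded algebra
    Nonempty (GradedAlgebra mu.grading) ∧
    ∃ d : L.Alg →ₗ[ZMod 2] L.Alg,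
      -- `d = ∑_{n ≥ 1} d_n` on generators
      (∀ v, d (TensorAlgebra.ι (ZMod 2) v) = ∑ᶠ (n : ℕ) (_ : 1 ≤ n), C.dn n v) ∧
      -- the Leibniz rule (over `ℤ/2` there are no signs)
      (∀ u v, d (u * v) = d u * v + u * d v) ∧
      -- these two properties determine `d`
      (∀ d' : L.Alg →ₗ[ZMod 2] L.Alg,
        (∀ v, d' (TensorAlgebra.ι (ZMod 2) v) = ∑ᶠ (n : ℕ) (_ : 1 ≤ n), C.dn n v) →
        (∀ u v, d' (u * v) = d' u * v + u * d' v) → d' = d) ∧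
      -- `d` has degree `-1`
      (∀ k, ∀ u ∈ mu.grading k, d u ∈ mu.grading (k - 1)) ∧
      d ∘ₗ d = 0 := by
  have hι : ∀ v, C.diff (TensorAlgebra.ι (ZMod 2) v) = ∑ᶠ (n : ℕ) (_ : 1 ≤ n), C.dn n v :=
    fun v => (C.diff_ι v).trans (C.finsum_dn hL.toIsGenericFront v).symm
  refine ⟨C.finite_iUnion_chordPaths, mu.nonempty_gradedAlgebra, C.diff, hι, C.diff_mul,
    fun d' h1 h2 => TensorAlgebra.eq_of_leibniz h2 C.diff_mul fun v => (h1 v).trans (hι v).symm,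
    mu.map_mem_grading C.diff_mul fun a => ?_, C.diff_comp_diff hL⟩
  rw [C.diff_ι, C.genMap_single]
  exact C.genDiff_mem_grading hL.toIsGenericFront a
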